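/- **Setting.** Composition is written diagrammatically, and categories are small (relative to a fixed universe). A *restriction category* is a category with an operation sending $f\colon A\to B$ to $\bar f\colon A\to A$ such that $\bar f f=f$; $\bar f\bar g=\bar g\bar f$ and $\bar g\bar f=\overline{\bar g f}$ for $f,g$ with the same domain; and $f\bar g=\overline{fg}\,f$ for composable $f,g$. A morphism $f\colon A\to B$ is *total* if $\bar f=\mathsf{id}_A$, and a *restriction idempotent* is an $e$ with $e=\bar e$. $\mathbf{RCat}$ is the 2-category of restriction categories, functors preserving $\overline{(-)}$, and natural transformations with total components. A restriction category is *split* if every restriction idempotent $e\colon A\to A$ splits, i.e. $e=rs$ with $s\colon E\to A$, $r\colon A\to E$, $sr=\mathsf{id}_E$. A *local category* is a category in which every object $M$ has an assigned object $\mathsf LM$ and monomorphism $\eta_M\colon M\to\mathsf LM$ such that $\mathsf L\mathsf LM=\mathsf LM$, $\eta_{\mathsf LM}=\mathsf{id}_{\mathsf LM}$, and such that for every $f\colon N\to\mathsf LM$ there is a pullback $P$ of $\eta_M$ along $f$, with projection $m\colon P\to N$, satisfying $\mathsf LP=\mathsf LN$ and $m\eta_N=\eta_P$. An object $M$ is *total*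 if $M=\mathsf LM$ and $\eta_M=\mathsf{id}_M$. $\mathbf{LCat}$ is the 2-category of local categories; functors that strictly preserve $\mathsf L$ and $\eta$ and preserve every pullback of an $\eta_N$ along a morphism $M\to\mathsf LN$; and natural transformations whose naturality square at every $\eta_M$ is a pullback. An object *splits* if it is isomorphic to a total object, and a local category is *split* if all its objects split. $\mathbf{sRCat}\subseteq\mathbf{RCat}$ and $\mathbf{sLCat}\subseteq\mathbf{LCat}$ are the full sub-2-categories on the split objects. The 2-functor $\mathcal L\colon\mathbf{RCat}\to\mathbf{LCat}$ sends $\mathbb X$ to the local category with objects $(A,a)$, $a=\bar a\colon A\to A$, and with morphisms $(A,a)\to(B,b)$ the $f\colon A\to B$ with $\bar f=a$ and $fb=f$, where $\mathsf L(A,a)=(A,\mathsf{id}_A)$ and $\eta_{(A,a)}=a$; it sends $F$ to $(A,a)\mapsto(FA,Fa)$, $f\mapsto Ff$, and $\varphi\colon F\Rightarrow G$ to $(Fa)\varphi_A$. The 2-functor $\mathcal R\colon\mathbf{LCat}\to\mathbf{RCat}$ sends $\mathbb C$ to the restriction category with objects the total objects of $\mathbb C$, and with morphisms $M\to N$ the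 classes $[U,f]$ of pairs with $\mathsf LU=M$, $f\colon U\to N$, modulo isomorphisms $\varphi\colon U\to V$ with $\varphi\eta_V=\eta_U$ and $\varphi g=f$ (identifying $(U,f)$ with $(V,g)$), composed by pullback, where $\overline{[U,f]}=[U,\eta_U]$; it sends $F$ to $M\mapsto FM$, $[U,f]\mapsto[FU,Ff]$, and $\varphi\colon F\Rightarrow G$ to $[FM,\varphi_M]$. **Theorem.** The following assignments define strictly 2-natural transformations $N\colon\mathrm{Id}_{\mathbf{RCat}}\to\mathcal R\mathcal L$ and $E\colon\mathrm{Id}_{\mathbf{LCat}}\to\mathcal L\mathcal R$: $$N_{\mathbb X}\colon A\mapsto(A,\mathsf{id}_A),\quad f\mapsto[(A,\bar f),f],\qquad\qquad E_{\mathbb C}\colon M\mapsto(\mathsf LM,[M,\eta_M]),\quad (f\colon M\to N)\mapsto[M,f\eta_N].$$ Every $N_{\mathbb X}$ is an isomorphism in $\mathbf{RCat}$, every $E_{\mathbb C}$ is an (internal) equivalence in $\mathbf{LCat}$, and the triangle identities $\mathcal L(N_{\mathbb X})=E_{\mathcal L\mathbb X}$ and $\mathcal R(E_{\mathbb C})=N_{\mathcal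 R\mathbb C}$ hold strictly; thus $\mathcal L,\mathcal R,N,E$ form a 2-equivalence $\mathbf{RCat}\simeq\mathbf{LCat}$ (an equivalence of 2-categories). Moreover $\mathcal L$ sends split restriction categories to split local categories, $\mathcal R$ sends split local categories to split restriction categories, and the restrictions of $\mathcal L,\mathcal R,N,E$ to the full sub-2-categories form, in the same sense, a 2-equivalence $\mathbf{sRCat}\simeq\mathbf{sLCat}$, again with every $N_{\mathbb X}$ an isomorphism in $\mathbf{sRCat}$. -/

import Mathlib

open CategoryTheory CategoryTheory.Limits CategoryTheory.Bicategory

universe u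

namespace Partiality

/-! ### Restriction categories -/

/-- A restriction structure on a category: every `f : A ⟶ B` has a restriction idempotent
`res f : A ⟶ A`, subject to the four restriction axioms (composition is diagrammatic). -/
class RestrictionStructure (X : Type u) [Category.{u} X] where
  res : ∀ {A B : X}, (A ⟶ B) → (A ⟶ A)
  res_comp_self : ∀ {A B : X} (f : A ⟶ B), res f ≫ f = f
  res_comm : ∀ {A B C : X} (f : A ⟶ B) (g : A ⟶ C), res f ≫ res g = res g ≫ res f
  res_comp_res : ∀ {A B C : X} (f : A ⟶ B) (g : A ⟶ C), res g ≫ res f = res (res g ≫ f)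
  comp_res : ∀ {A B C : X} (f : A ⟶ B) (g : B ⟶ C), f ≫ res g = res (f ≫ g) ≫ f

open RestrictionStructure (res)

section Restriction

variable {X : Type u} [Category.{u} X] [RestrictionStructure X]

/-- A morphism is total when its restriction idempotent is the identity. -/
def IsTotalHom {A B : X} (f : A ⟶ B) : Prop := res f = 𝟙 A

lemma res_id (A : X) : res (𝟙 A) = 𝟙 A := by
  simpa using RestrictionStructure.res_comp_self (𝟙 A)

lemma res_res {A B : X} (f : A ⟶ B) : res (res f) = res f := by
  have h := RestrictionStructure.res_comp_res (𝟙 A) f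
  simpa [res_id] using h.symm

lemma res_idem {A B : X} (f : A ⟶ B) : res f ≫ res f = res f := by
  rw [RestrictionStructure.res_comp_res, RestrictionStructure.res_comp_self]

lemma res_comp_eq {A B C : X} (f : A ⟶ B) (g : B ⟶ C) : res (f ≫ g) = res (f ≫ res g) := by
  rw [RestrictionStructure.comp_res, ← RestrictionStructure.res_comp_res,
    RestrictionStructure.res_comm, RestrictionStructure.res_comp_res, ← Category.assoc,
    RestrictionStructure.res_comp_self]

lemma IsTotalHom.id (A : X) : IsTotalHom (𝟙 A) := res_id A

lemma IsTotalHom.comp {A B C : X} {f : A ⟶ B} {g : B ⟶ C} (hf : IsTotalHom f)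
    (hg : IsTotalHom g) : IsTotalHom (f ≫ g) := by
  rw [IsTotalHom, res_comp_eq, hg, Category.comp_id, hf]

end Restriction

/-- A restriction functor: a functor preserving restriction idempotents. -/
structure RestrictionFunctor (X Y : Type u) [Category.{u} X] [Category.{u} Y]
    [RestrictionStructure X] [RestrictionStructure Y] extends X ⥤ Y where
  map_res : ∀ {A B : X} (f : A ⟶ B), toFunctor.map (res f) = res (toFunctor.map f)

section

variable {X Y : Type u} [Category.{u} X] [Category.{u} Y]
  [RestrictionStructure X] [RestrictionStructure Y]

@[ext]
lemma RestrictionFunctor.ext' {F G : RestrictionFunctor X Y} (h : F.toFunctor = G.toFunctor) :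
    F = G := by
  cases F; cases G; cases h; rfl

lemma RestrictionFunctor.map_isTotalHom (F : RestrictionFunctor X Y) {A B : X} {f : A ⟶ B}
    (hf : IsTotalHom f) : IsTotalHom (F.map f) := by
  rw [IsTotalHom, ← F.map_res, hf, F.map_id]

/-- A total natural transformation of restriction functors: a natural transformation all of whose
components are total. -/
@[ext]
structure TotalTrans (F G : RestrictionFunctor X Y) where
  nat : F.toFunctor ⟶ G.toFunctor
  total : ∀ A : X, IsTotalHom (nat.app A)

instance : Category (RestrictionFunctor X Y) where
  Hom F G := TotalTrans F G
  id F := ⟨𝟙 F.toFunctor, fun A => IsTotalHom.id _⟩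
  comp φ ψ := ⟨φ.nat ≫ ψ.nat, fun A => (φ.total A).comp (ψ.total A)⟩

end

/-- A (small) restriction category. -/
structure RCat : Type (u + 1) where
  carrier : Type u
  [cat : Category.{u} carrier]
  [str : RestrictionStructure carrier]

attribute [instance] RCat.cat RCat.str

namespace RCat

instance : CategoryStruct RCat.{u} where
  Hom X Y := RestrictionFunctor X.carrier Y.carrier
  id X := { 𝟭 X.carrier with map_res := fun _ => rfl }
  comp F G := { F.toFunctor ⋙ G.toFunctor with
    map_res := fun f => by
      change G.map (F.map (res f)) = res (G.map (F.map f))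
      rw [F.map_res, G.map_res] }

instance homCategory (X Y : RCat.{u}) : Category (X ⟶ Y) :=
  inferInstanceAs (Category (RestrictionFunctor X.carrier Y.carrier))

@[ext]
lemma hom₂_ext {X Y : RCat.{u}} {F G : X ⟶ Y} {φ ψ : F ⟶ G}
    (h : ∀ A, φ.nat.app A = ψ.nat.app A) : φ = ψ :=
  TotalTrans.ext (NatTrans.ext (funext h))

@[simp] lemma comp_obj {X Y Z : RCat.{u}} (F : X ⟶ Y) (G : Y ⟶ Z) (A : X.carrier) :
    (F ≫ G).obj A = G.obj (F.obj A) := rfl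

@[simp] lemma comp_map {X Y Z : RCat.{u}} (F : X ⟶ Y) (G : Y ⟶ Z) {A B : X.carrier} (f : A ⟶ B) :
    (F ≫ G).map f = G.map (F.map f) := rfl

@[simp] lemma id_obj {X : RCat.{u}} (A : X.carrier) : (RestrictionFunctor.toFunctor (𝟙 X)).obj A = A := rfl

@[simp] lemma id_map {X : RCat.{u}} {A B : X.carrier} (f : A ⟶ B) :
    (RestrictionFunctor.toFunctor (𝟙 X)).map f = f := rfl

@[simp] lemma comp_nat {X Y : RCat.{u}} {F G H : X ⟶ Y} (φ : F ⟶ G) (ψ : G ⟶ H) (A : X.carrier) :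
    (φ ≫ ψ).nat.app A = φ.nat.app A ≫ ψ.nat.app A := rfl

@[simp] lemma id_nat {X Y : RCat.{u}} (F : X ⟶ Y) (A : X.carrier) :
    (TotalTrans.nat (𝟙 F)).app A = 𝟙 (F.obj A) := rfl

/-- Two 2-cells with the same components agree, up to the identification of their boundaries. -/
lemma eq_eqToHom_comp {X Y : RCat.{u}} {F G F' G' : X ⟶ Y} (hF : F = F') (hG : G' = G)
    {φ : F ⟶ G} {ψ : F' ⟶ G'} (h : ∀ A, HEq (φ.nat.app A) (ψ.nat.app A)) :
    φ = eqToHom hF ≫ ψ ≫ eqToHom hG := by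
  subst hF hG
  rw [eqToHom_refl, eqToHom_refl, Category.comp_id, Category.id_comp]
  exact hom₂_ext fun A => eq_of_heq (h A)

/-- Restriction categories, restriction functors and total natural transformations form a
2-category: all structure 2-cells are identities, and whiskering is the usual one. -/
instance : Bicategory RCat.{u} where
  homCategory := homCategory
  whiskerLeft F _ _ φ := ⟨Functor.whiskerLeft F.toFunctor φ.nat, fun A => φ.total (F.obj A)⟩
  whiskerRight φ H := ⟨Functor.whiskerRight φ.nat H.toFunctor,
    fun A => H.map_isTotalHom (φ.total A)⟩
  associator F G H := Iso.refl (F ≫ G ≫ H)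
  leftUnitor F := Iso.refl F
  rightUnitor F := Iso.refl F
  whiskerLeft_id _ _ := rfl
  whiskerLeft_comp _ _ _ _ _ _ := rfl
  id_whiskerLeft φ := by
    ext A
    change φ.nat.app A = 𝟙 _ ≫ φ.nat.app A ≫ 𝟙 _
    simp
  comp_whiskerLeft F G _ _ φ := by
    ext A
    change φ.nat.app (G.obj (F.obj A)) = 𝟙 _ ≫ φ.nat.app (G.obj (F.obj A)) ≫ 𝟙 _
    simp
  id_whiskerRight F G := by
    ext A
    exact G.map_id _
  comp_whiskerRight φ ψ H := by
    ext A
    exact H.map_comp _ _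
  whiskerRight_id φ := by
    ext A
    change φ.nat.app A = 𝟙 _ ≫ φ.nat.app A ≫ 𝟙 _
    simp
  whiskerRight_comp φ G H := by
    ext A
    change H.map (G.map (φ.nat.app A)) = 𝟙 _ ≫ H.map (G.map (φ.nat.app A)) ≫ 𝟙 _
    simp
  whisker_assoc F _ _ φ H := by
    ext A
    change H.map (φ.nat.app (F.obj A)) = 𝟙 _ ≫ H.map (φ.nat.app (F.obj A)) ≫ 𝟙 _
    simp
  whisker_exchange φ ψ := by
    ext A
    exact (ψ.nat.naturality (φ.nat.app A)).symm
  pentagon F G H K := by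
    ext A
    change K.map (𝟙 _) ≫ 𝟙 _ ≫ 𝟙 _ = 𝟙 _ ≫ 𝟙 _
    simp
  triangle F G := by
    ext A
    change 𝟙 _ ≫ 𝟙 _ = G.map (𝟙 _)
    simp

instance : Bicategory.Strict RCat.{u} where
  id_comp _ := rfl
  comp_id _ := rfl
  assoc _ _ _ := rfl
  leftUnitor_eqToIso _ := rfl
  rightUnitor_eqToIso _ := rfl
  associator_eqToIso _ _ _ := rfl

end RCat
/-! ### Local categories -/

/-- A local structure on a category: every object `M` has an enlargement `enl M` and a maximal
inclusion `η M : M ⟶ enl M`, subject to the three axioms of a local category.  Equalities of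
objects are used to compare morphisms through `eqToHom`. -/
class LocalStructure (C : Type u) [Category.{u} C] where
  enl : C → C
  η : ∀ M : C, M ⟶ enl M
  enl_enl : ∀ M : C, enl (enl M) = enl M
  η_enl : ∀ M : C, η (enl M) = eqToHom (enl_enl M).symm
  mono_η : ∀ M : C, Mono (η M)
  exists_isPullback : ∀ {M N : C} (f : N ⟶ enl M),
    ∃ (P : C) (p : P ⟶ M) (m : P ⟶ N) (h : enl P = enl N),
      IsPullback p m (η M) f ∧ m ≫ η N = η P ≫ eqToHom h

open LocalStructure (enl η)

attribute [instance] LocalStructure.mono_η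

section Local

variable {C : Type u} [Category.{u} C] [LocalStructure C]

/-- A total object: one which coincides with its enlargement, the maximal inclusion being the
identity. -/
def IsTotalObj (M : C) : Prop := ∃ h : enl M = M, η M = eqToHom h.symm

/-- An object splits when it is isomorphic to a total object. -/
def ObjSplits (M : C) : Prop := ∃ E : C, IsTotalObj E ∧ Nonempty (M ≅ E)

lemma isTotalObj_enl (M : C) : IsTotalObj (enl M) :=
  ⟨LocalStructure.enl_enl M, LocalStructure.η_enl M⟩

lemma η_congr {M N : C} (h : M = N) :
    η M = eqToHom h ≫ η N ≫ eqToHom (congrArg enl h.symm) := by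
  subst h; simp

end Local

/-- A local functor: a functor which strictly preserves enlargements and maximal inclusions, and
which preserves every pullback of a maximal inclusion `η N` along a morphism `f : M ⟶ enl N`. -/
structure LocalFunctor (C D : Type u) [Category.{u} C] [Category.{u} D]
    [LocalStructure C] [LocalStructure D] extends C ⥤ D where
  map_enl : ∀ M : C, toFunctor.obj (enl M) = enl (toFunctor.obj M)
  map_η : ∀ M : C, toFunctor.map (η M) = η (toFunctor.obj M) ≫ eqToHom (map_enl M).symm
  map_isPullback : ∀ {M N P : C} {p : P ⟶ N} {m : P ⟶ M} {f : M ⟶ enl N},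
    IsPullback p m (η N) f →
      IsPullback (toFunctor.map p) (toFunctor.map m) (toFunctor.map (η N)) (toFunctor.map f)

section

variable {C D : Type u} [Category.{u} C] [Category.{u} D] [LocalStructure C] [LocalStructure D]

lemma LocalFunctor.ext' {F G : LocalFunctor C D} (h : F.toFunctor = G.toFunctor) : F = G := by
  cases F; cases G; cases h; rfl

lemma LocalFunctor.map_isTotalObj (F : LocalFunctor C D) {M : C} (hM : IsTotalObj M) :
    IsTotalObj (F.obj M) := by
  obtain ⟨h, e⟩ := hM
  refine ⟨(F.map_enl M).symm.trans (congrArg F.obj h), ?_⟩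
  have := F.map_η M
  rw [e, eqToHom_map] at this
  rw [← cancel_mono (eqToHom (F.map_enl M).symm), ← this]
  simp

/-- A total natural transformation of local functors: a natural transformation whose naturality
square at every maximal inclusion is a pullback. -/
@[ext]
structure TotalLocalTrans (F G : LocalFunctor C D) where
  nat : F.toFunctor ⟶ G.toFunctor
  total : ∀ M : C,
    IsPullback (nat.app M) (F.map (η M)) (G.map (η M)) (nat.app (enl M))

instance : Category (LocalFunctor C D) where
  Hom F G := TotalLocalTrans F G
  id F := ⟨𝟙 F.toFunctor, fun M => by
    simpa using IsPullback.of_horiz_isIso (CommSq.mk (by simp))⟩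
  comp φ ψ := ⟨φ.nat ≫ ψ.nat, fun M => (φ.total M).paste_horiz (ψ.total M)⟩

/-- The naturality square of a total natural transformation at a maximal inclusion is still a
pullback after applying a local functor. -/
lemma TotalLocalTrans.map_isPullback {B : Type u} [Category.{u} B] [LocalStructure B]
    {F G : LocalFunctor C D} (φ : TotalLocalTrans F G) (H : LocalFunctor D B) (M : C) :
    IsPullback (H.map (φ.nat.app M)) (H.map (F.map (η M))) (H.map (G.map (η M)))
      (H.map (φ.nat.app (enl M))) := by
  have h₁ : IsPullback (φ.nat.app M) (F.map (η M)) (η (G.obj M))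
      (φ.nat.app (enl M) ≫ eqToHom (G.map_enl M)) := by
    refine IsPullback.of_iso (φ.total M) (Iso.refl _) (Iso.refl _) (Iso.refl _)
      (eqToIso (G.map_enl M)) ?_ ?_ ?_ ?_ <;> simp [G.map_η]
  have h₂ := H.map_isPullback h₁
  refine IsPullback.of_iso h₂ (Iso.refl _) (Iso.refl _) (Iso.refl _)
      (H.mapIso (eqToIso (G.map_enl M)).symm) ?_ ?_ ?_ ?_
  · simp
  · simp
  · simp [G.map_η]
  · change H.map (_ ≫ _) ≫ H.map (eqToHom (G.map_enl M).symm) = 𝟙 _ ≫ H.map _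
    rw [← H.map_comp]
    simp

/-- A total natural transformation restricted along a local functor is total. -/
lemma TotalLocalTrans.isPullback_obj {B : Type u} [Category.{u} B] [LocalStructure B]
    {F G : LocalFunctor C D} (K : LocalFunctor B C) (φ : TotalLocalTrans F G) (M : B) :
    IsPullback (φ.nat.app (K.obj M)) (F.map (K.map (η M))) (G.map (K.map (η M)))
      (φ.nat.app (K.obj (enl M))) := by
  refine IsPullback.of_iso (φ.total (K.obj M)) (Iso.refl _) (Iso.refl _)
    (F.mapIso (eqToIso (K.map_enl M).symm)) (G.mapIso (eqToIso (K.map_enl M).symm)) ?_ ?_ ?_ ?_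
  · simp
  · simp [K.map_η]
  · simp [K.map_η]
  · simp

end

/-- A (small) local category. -/
structure LCat : Type (u + 1) where
  carrier : Type u
  [cat : Category.{u} carrier]
  [str : LocalStructure carrier]

attribute [instance] LCat.cat LCat.str

namespace LCat

instance : CategoryStruct LCat.{u} where
  Hom C D := LocalFunctor C.carrier D.carrier
  id C :=
    { 𝟭 C.carrier with
      map_enl := fun _ => rfl
      map_η := fun M => (Category.comp_id (η M)).symm
      map_isPullback := fun h => h }
  comp F G :=
    { F.toFunctor ⋙ G.toFunctor with
      map_enl := fun M => (congrArg G.obj (F.map_enl M)).trans (G.map_enl _)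
      map_η := fun M => by
        change G.map (F.map (η M)) = η (G.obj (F.obj M)) ≫ _
        rw [F.map_η, G.map_comp, G.map_η, eqToHom_map]
        simp
      map_isPullback := fun {M N P p m f} h => by
        have h₁ : IsPullback (F.map p) (F.map m) (η (F.obj N))
            (F.map f ≫ eqToHom (F.map_enl N)) := by
          refine IsPullback.of_iso (F.map_isPullback h) (Iso.refl _) (Iso.refl _) (Iso.refl _)
            (eqToIso (F.map_enl N)) ?_ ?_ ?_ ?_ <;> simp [F.map_η]
        refine IsPullback.of_iso (G.map_isPullback h₁) (Iso.refl _) (Iso.refl _) (Iso.refl _)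
          (G.mapIso (eqToIso (F.map_enl N)).symm) ?_ ?_ ?_ ?_
        · simp
        · simp
        · simp [F.map_η]
        · change G.map (_ ≫ _) ≫ G.map (eqToHom (F.map_enl N).symm) = 𝟙 _ ≫ G.map _
          rw [← G.map_comp]
          simp }

instance homCategory (C D : LCat.{u}) : Category (C ⟶ D) :=
  inferInstanceAs (Category (LocalFunctor C.carrier D.carrier))

@[ext]
lemma hom₂_ext {C D : LCat.{u}} {F G : C ⟶ D} {φ ψ : F ⟶ G}
    (h : ∀ A, φ.nat.app A = ψ.nat.app A) : φ = ψ :=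
  TotalLocalTrans.ext (NatTrans.ext (funext h))

@[simp] lemma comp_obj {X Y Z : LCat.{u}} (F : X ⟶ Y) (G : Y ⟶ Z) (A : X.carrier) :
    (F ≫ G).obj A = G.obj (F.obj A) := rfl

@[simp] lemma comp_map {X Y Z : LCat.{u}} (F : X ⟶ Y) (G : Y ⟶ Z) {A B : X.carrier} (f : A ⟶ B) :
    (F ≫ G).map f = G.map (F.map f) := rfl

@[simp] lemma id_obj {X : LCat.{u}} (A : X.carrier) :
    (LocalFunctor.toFunctor (𝟙 X)).obj A = A := rfl

@[simp] lemma id_map {X : LCat.{u}} {A B : X.carrier} (f : A ⟶ B) :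
    (LocalFunctor.toFunctor (𝟙 X)).map f = f := rfl

@[simp] lemma comp_nat {X Y : LCat.{u}} {F G H : X ⟶ Y} (φ : F ⟶ G) (ψ : G ⟶ H) (A : X.carrier) :
    (φ ≫ ψ).nat.app A = φ.nat.app A ≫ ψ.nat.app A := rfl

@[simp] lemma id_nat {X Y : LCat.{u}} (F : X ⟶ Y) (A : X.carrier) :
    (TotalLocalTrans.nat (𝟙 F)).app A = 𝟙 (F.obj A) := rfl

/-- Two 2-cells with the same components agree, up to the identification of their boundaries. -/
lemma eq_eqToHom_comp {X Y : LCat.{u}} {F G F' G' : X ⟶ Y} (hF : F = F') (hG : G' = G)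
    {φ : F ⟶ G} {ψ : F' ⟶ G'} (h : ∀ A, HEq (φ.nat.app A) (ψ.nat.app A)) :
    φ = eqToHom hF ≫ ψ ≫ eqToHom hG := by
  subst hF hG
  rw [eqToHom_refl, eqToHom_refl, Category.comp_id, Category.id_comp]
  exact hom₂_ext fun A => eq_of_heq (h A)

/-- Local categories, local functors and total natural transformations form a 2-category: all
structure 2-cells are identities, and whiskering is the usual one. -/
instance : Bicategory LCat.{u} where
  homCategory := homCategory
  whiskerLeft F _ _ φ := ⟨Functor.whiskerLeft F.toFunctor φ.nat, fun M => φ.isPullback_obj F M⟩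
  whiskerRight φ H := ⟨Functor.whiskerRight φ.nat H.toFunctor, fun M => φ.map_isPullback H M⟩
  associator F G H := Iso.refl (F ≫ G ≫ H)
  leftUnitor F := Iso.refl F
  rightUnitor F := Iso.refl F
  whiskerLeft_id _ _ := rfl
  whiskerLeft_comp _ _ _ _ _ _ := rfl
  id_whiskerLeft φ := by
    ext A
    change φ.nat.app A = 𝟙 _ ≫ φ.nat.app A ≫ 𝟙 _
    simp
  comp_whiskerLeft F G _ _ φ := by
    ext A
    change φ.nat.app (G.obj (F.obj A)) = 𝟙 _ ≫ φ.nat.app (G.obj (F.obj A)) ≫ 𝟙 _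
    simp
  id_whiskerRight F G := by
    ext A
    exact G.map_id _
  comp_whiskerRight φ ψ H := by
    ext A
    exact H.map_comp _ _
  whiskerRight_id φ := by
    ext A
    change φ.nat.app A = 𝟙 _ ≫ φ.nat.app A ≫ 𝟙 _
    simp
  whiskerRight_comp φ G H := by
    ext A
    change H.map (G.map (φ.nat.app A)) = 𝟙 _ ≫ H.map (G.map (φ.nat.app A)) ≫ 𝟙 _
    simp
  whisker_assoc F _ _ φ H := by
    ext A
    change H.map (φ.nat.app (F.obj A)) = 𝟙 _ ≫ H.map (φ.nat.app (F.obj A)) ≫ 𝟙 _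
    simp
  whisker_exchange φ ψ := by
    ext A
    exact (ψ.nat.naturality (φ.nat.app A)).symm
  pentagon F G H K := by
    ext A
    change K.map (𝟙 _) ≫ 𝟙 _ ≫ 𝟙 _ = 𝟙 _ ≫ 𝟙 _
    simp
  triangle F G := by
    ext A
    change 𝟙 _ ≫ 𝟙 _ = G.map (𝟙 _)
    simp

instance : Bicategory.Strict LCat.{u} where
  id_comp _ := rfl
  comp_id _ := rfl
  assoc _ _ _ := rfl
  leftUnitor_eqToIso _ := rfl
  rightUnitor_eqToIso _ := rfl
  associator_eqToIso _ _ _ := rfl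

end LCat

/-! ### From restriction categories to local categories -/

/-- An object of the local category of a restriction category: an object together with a
restriction idempotent on it. -/
structure LocObj (X : Type u) [Category.{u} X] [RestrictionStructure X] where
  base : X
  idem : base ⟶ base
  res_idem : res idem = idem

/-- A morphism `(A, a) ⟶ (B, b)`: a morphism `f : A ⟶ B` with `res f = a` and `f ≫ b = f`. -/
@[ext]
structure LocHom {X : Type u} [Category.{u} X] [RestrictionStructure X] (A B : LocObj X) where
  hom : A.base ⟶ B.base
  res_hom : res hom = A.idem
  hom_idem : hom ≫ B.idem = hom

section Loc

variable {X : Type u} [Category.{u} X] [RestrictionStructure X]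

lemma LocObj.idem_idem (A : LocObj X) : A.idem ≫ A.idem = A.idem := by
  have := Partiality.res_idem A.idem
  rwa [A.res_idem] at this

lemma LocHom.idem_hom {A B : LocObj X} (f : LocHom A B) : A.idem ≫ f.hom = f.hom := by
  rw [← f.res_hom, RestrictionStructure.res_comp_self]

instance : Category (LocObj X) where
  Hom A B := LocHom A B
  id A := ⟨A.idem, A.res_idem, A.idem_idem⟩
  comp {A B D} f g := ⟨f.hom ≫ g.hom, by
    rw [res_comp_eq, g.res_hom, f.hom_idem, f.res_hom], by
    rw [Category.assoc, g.hom_idem]⟩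
  id_comp f := LocHom.ext f.idem_hom
  comp_id f := LocHom.ext f.hom_idem
  assoc f g h := LocHom.ext (Category.assoc _ _ _)

@[ext]
lemma LocObj.hom_ext {A B : LocObj X} {f g : A ⟶ B} (h : f.hom = g.hom) : f = g := LocHom.ext h

@[simp] lemma LocObj.comp_hom {A B D : LocObj X} (f : A ⟶ B) (g : B ⟶ D) :
    (f ≫ g).hom = f.hom ≫ g.hom := rfl

@[simp] lemma LocObj.id_hom (A : LocObj X) : LocHom.hom (𝟙 A) = A.idem := rfl

lemma LocObj.eqToHom_hom {A B : LocObj X} (h : A = B) :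
    (eqToHom h).hom = A.idem ≫ eqToHom (congrArg LocObj.base h) := by
  subst h; simp

/-- A recognition principle for the pullbacks of maximal inclusions. -/
lemma LocObj.isPullback_of {Y Z : X} {a d : Y ⟶ Y} {e b : Z ⟶ Z} {ha : res a = a}
    {hd : res d = d} {he : res e = e} {hb : res b = b}
    (p : (⟨Z, e, he⟩ : LocObj X) ⟶ ⟨Y, a, ha⟩) (m : (⟨Z, e, he⟩ : LocObj X) ⟶ ⟨Z, b, hb⟩)
    (q : (⟨Y, a, ha⟩ : LocObj X) ⟶ ⟨Y, d, hd⟩) (f : (⟨Z, b, hb⟩ : LocObj X) ⟶ ⟨Y, d, hd⟩)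
    (hq : q.hom = a) (hm : m.hom = e) (hp : p.hom = f.hom ≫ a) (hef : e = res (f.hom ≫ a)) :
    IsPullback p m q f := by
  have haa : a ≫ a = a := LocObj.idem_idem ⟨Y, a, ha⟩
  refine ⟨⟨?_⟩, ⟨PullbackCone.IsLimit.mk _
    (fun s => ⟨s.snd.hom, s.snd.res_hom, ?_⟩) ?_ ?_ ?_⟩⟩
  · ext
    simp only [LocObj.comp_hom]
    rw [hq, hm, hp, hef, Category.assoc, haa, ← RestrictionStructure.comp_res, ha]
  · have hw : s.fst.hom ≫ a = s.snd.hom ≫ f.hom := by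
      have := congrArg LocHom.hom s.condition
      simp only [LocObj.comp_hom] at this
      rwa [hq] at this
    have hfa : s.fst.hom ≫ a = s.fst.hom := s.fst.hom_idem
    change s.snd.hom ≫ e = s.snd.hom
    rw [hef, RestrictionStructure.comp_res, ← Category.assoc, ← hw, hfa, hfa, s.fst.res_hom,
      ← s.snd.res_hom, RestrictionStructure.res_comp_self]
  · intro s
    have hw : s.fst.hom ≫ a = s.snd.hom ≫ f.hom := by
      have := congrArg LocHom.hom s.condition
      simp only [LocObj.comp_hom] at this
      rwa [hq] at this
    have hfa : s.fst.hom ≫ a = s.fst.hom := s.fst.hom_idem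
    ext
    change s.snd.hom ≫ p.hom = s.fst.hom
    rw [hp, ← Category.assoc, ← hw, hfa, hfa]
  · intro s
    have hw : s.fst.hom ≫ a = s.snd.hom ≫ f.hom := by
      have := congrArg LocHom.hom s.condition
      simp only [LocObj.comp_hom] at this
      rwa [hq] at this
    have hfa : s.fst.hom ≫ a = s.fst.hom := s.fst.hom_idem
    ext
    change s.snd.hom ≫ m.hom = s.snd.hom
    rw [hm, hef, RestrictionStructure.comp_res, ← Category.assoc, ← hw, hfa, hfa, s.fst.res_hom,
      ← s.snd.res_hom, RestrictionStructure.res_comp_self]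
  · intro s t _ h₂
    ext
    have h₃ : t.hom ≫ e = t.hom := t.hom_idem
    have h₄ : t.hom ≫ m.hom = s.snd.hom := congrArg LocHom.hom h₂
    rw [hm, h₃] at h₄
    exact h₄

/-- The local structure: `(A, a)` has enlargement `(A, 𝟙 A)` and maximal inclusion `a`. -/
instance : LocalStructure (LocObj X) where
  enl A := ⟨A.base, 𝟙 A.base, res_id A.base⟩
  η A := ⟨A.idem, A.res_idem, Category.comp_id _⟩
  enl_enl _ := rfl
  η_enl _ := rfl
  mono_η A := ⟨fun {B} g h w => by
    ext
    have hw : g.hom ≫ A.idem = h.hom ≫ A.idem := congrArg LocHom.hom w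
    rwa [g.hom_idem, h.hom_idem] at hw⟩
  exists_isPullback {A B} f := by
    have hb : res (f.hom ≫ A.idem) ≫ B.idem = res (f.hom ≫ A.idem) := by
      rw [← B.res_idem, RestrictionStructure.res_comm, RestrictionStructure.res_comp_res,
        B.res_idem, ← Category.assoc, f.idem_hom]
    refine ⟨⟨B.base, res (f.hom ≫ A.idem), res_res _⟩,
      ⟨f.hom ≫ A.idem, rfl, by rw [Category.assoc, A.idem_idem]⟩,
      ⟨res (f.hom ≫ A.idem), res_res _, hb⟩, rfl, ?_, ?_⟩
    · exact LocObj.isPullback_of _ _ _ _ rfl rfl rfl rfl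
    · ext
      change res (f.hom ≫ A.idem) ≫ B.idem = res (f.hom ≫ A.idem) ≫ 𝟙 _
      rw [hb, Category.comp_id]

end Loc

section LocFunctor

variable {X Y : Type u} [Category.{u} X] [Category.{u} Y]
  [RestrictionStructure X] [RestrictionStructure Y]

/-- The functor induced by a restriction functor: `(A, a) ↦ (F A, F a)` and `f ↦ F f`. -/
def locFunctorAux (F : RestrictionFunctor X Y) : LocObj X ⥤ LocObj Y where
  obj A := ⟨F.obj A.base, F.map A.idem, by rw [← F.map_res, A.res_idem]⟩
  map f := ⟨F.map f.hom, (F.map_res f.hom).symm.trans (congrArg F.map f.res_hom),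
    by rw [← F.map_comp, f.hom_idem]⟩
  map_id _ := rfl
  map_comp f g := LocHom.ext (F.map_comp f.hom g.hom)

/-- The local functor induced by a restriction functor. -/
def RestrictionFunctor.loc (F : RestrictionFunctor X Y) :
    LocalFunctor (LocObj X) (LocObj Y) where
  toFunctor := locFunctorAux F
  map_enl A := by
    change (⟨F.obj A.base, F.map (𝟙 A.base), _⟩ : LocObj Y) = ⟨F.obj A.base, 𝟙 _, _⟩
    congr 1
    exact F.map_id _
  map_η A := by
    ext
    rw [LocObj.comp_hom, LocObj.eqToHom_hom]
    change F.map A.idem = F.map A.idem ≫ 𝟙 _ ≫ 𝟙 _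
    simp
  map_isPullback {B A P p m f} h := by
    have hb : res (f.hom ≫ A.idem) ≫ B.idem = res (f.hom ≫ A.idem) := by
      rw [← B.res_idem, RestrictionStructure.res_comm, RestrictionStructure.res_comp_res,
        B.res_idem, ← Category.assoc, f.idem_hom]
    let Q : LocObj X := ⟨B.base, res (f.hom ≫ A.idem), res_res _⟩
    let q : Q ⟶ A := ⟨f.hom ≫ A.idem, rfl, by rw [Category.assoc, A.idem_idem]⟩
    let n : Q ⟶ B := ⟨res (f.hom ≫ A.idem), res_res _, hb⟩
    have hQ : IsPullback q n (η A) f := LocObj.isPullback_of _ _ _ _ rfl rfl rfl rfl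
    have hFQ : IsPullback ((locFunctorAux F).map q) ((locFunctorAux F).map n)
        ((locFunctorAux F).map (η A)) ((locFunctorAux F).map f) := by
      refine LocObj.isPullback_of _ _ _ _ rfl rfl ?_ ?_
      · exact F.map_comp _ _
      · change F.map (res (f.hom ≫ A.idem)) = res (F.map f.hom ≫ F.map A.idem)
        rw [F.map_res, F.map_comp]
    let e : P ≅ Q := h.isoIsPullback _ _ hQ
    refine IsPullback.of_iso hFQ ((locFunctorAux F).mapIso e.symm) (Iso.refl _) (Iso.refl _)
      (Iso.refl _) ?_ ?_ ?_ ?_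
    · simp only [Functor.mapIso_hom, Iso.refl_hom, Category.comp_id, ← Functor.map_comp]
      congr 1
      simp [e]
    · simp only [Functor.mapIso_hom, Iso.refl_hom, Category.comp_id, ← Functor.map_comp]
      congr 1
      simp [e]
    · simp
    · simp

/-- The total natural transformation induced by a total natural transformation of restriction
functors; its component at `(A, a)` is `F a ≫ φ_A`. -/
def TotalTrans.loc {F G : RestrictionFunctor X Y} (φ : TotalTrans F G) :
    TotalLocalTrans F.loc G.loc where
  nat :=
    { app A := ⟨F.map A.idem ≫ φ.nat.app A.base, by
        change res (F.map A.idem ≫ φ.nat.app A.base) = F.map A.idem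
        rw [res_comp_eq, φ.total, Category.comp_id, ← F.map_res, A.res_idem], by
        change (F.map A.idem ≫ φ.nat.app A.base) ≫ G.map A.idem = _
        rw [Category.assoc, ← φ.nat.naturality, ← Category.assoc, ← F.map_comp, A.idem_idem]
        rfl⟩
      naturality A B f := by
        ext
        change F.map f.hom ≫ F.map B.idem ≫ φ.nat.app B.base =
          (F.map A.idem ≫ φ.nat.app A.base) ≫ G.map f.hom
        rw [Category.assoc, ← φ.nat.naturality, ← Category.assoc, ← Category.assoc,
          ← F.map_comp, ← F.map_comp, f.hom_idem, f.idem_hom] }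
  total A := by
    have h : F.map A.idem ≫ φ.nat.app A.base =
        (F.map (𝟙 A.base) ≫ φ.nat.app A.base) ≫ G.map A.idem := by
      rw [F.map_id, Category.id_comp, φ.nat.naturality]
    refine LocObj.isPullback_of _ _ _ _ rfl rfl h ?_
    change F.map A.idem = res ((F.map (𝟙 A.base) ≫ φ.nat.app A.base) ≫ G.map A.idem)
    rw [← h, res_comp_eq, φ.total, Category.comp_id, ← F.map_res, A.res_idem]

end LocFunctor

/-- The local category of a restriction category. -/
def RCat.loc (X : RCat.{u}) : LCat.{u} := ⟨LocObj X.carrier⟩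

/-- The 2-functor from restriction categories to local categories on 1-cells. -/
def RCat.locMap {X Y : RCat.{u}} (F : X ⟶ Y) : X.loc ⟶ Y.loc := RestrictionFunctor.loc F

/-- The 2-functor from restriction categories to local categories on 2-cells. -/
def RCat.locMap₂ {X Y : RCat.{u}} {F G : X ⟶ Y} (φ : F ⟶ G) : RCat.locMap F ⟶ RCat.locMap G :=
  TotalTrans.loc φ

/-- The 2-functor from restriction categories to local categories. -/
def locFunctor : StrictPseudofunctor RCat.{u} LCat.{u} :=
  StrictPseudofunctor.mk''
    { obj := RCat.loc
      map := RCat.locMap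
      map₂ := RCat.locMap₂
      map₂_id := fun {X Y} F => LCat.hom₂_ext fun A => LocObj.hom_ext (Category.comp_id _)
      map₂_comp := fun {X Y F G H} φ ψ => LCat.hom₂_ext fun A => LocObj.hom_ext (by
        change F.map A.idem ≫ φ.nat.app A.base ≫ ψ.nat.app A.base =
          (F.map A.idem ≫ φ.nat.app A.base) ≫ G.map A.idem ≫ ψ.nat.app A.base
        rw [Category.assoc, ← Category.assoc (φ.nat.app A.base) (G.map A.idem),
          ← φ.nat.naturality, ← Category.assoc, ← Category.assoc, ← Category.assoc,
          ← F.map_comp, A.idem_idem])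
      map_id := fun _ => rfl
      map_comp := fun _ _ => rfl
      map₂_whisker_left := fun F _ _ φ => LCat.eq_eqToHom_comp _ _ fun A => HEq.rfl
      map₂_whisker_right := fun {X Y Z F F'} φ G =>
        LCat.eq_eqToHom_comp (φ := RCat.locMap₂ (φ ▷ G)) (ψ := RCat.locMap₂ φ ▷ RCat.locMap G)
          _ _ fun A => heq_of_eq (LocObj.hom_ext
            (G.map_comp (F.map A.idem) (φ.nat.app A.base)).symm) }

/-! ### From local categories to restriction categories -/

/-- The objects of the restriction category of a local category: the total objects. -/
structure ResObj (C : Type u) [Category.{u} C] [LocalStructure C] where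
  obj : C
  total : IsTotalObj obj

/-- A partial map `A ⇀ B` between total objects: an object `dom` with `enl dom = A` together with a
morphism `hom : dom ⟶ B`. -/
structure PMap {C : Type u} [Category.{u} C] [LocalStructure C] (A B : ResObj C) where
  dom : C
  enl_dom : enl dom = A.obj
  hom : dom ⟶ B.obj

section Res

variable {C : Type u} [Category.{u} C] [LocalStructure C]

namespace PMap

variable {A B D E : ResObj C}

/-- The maximal inclusion of the domain of a partial map, regarded as a morphism to `A`. -/
def incl (U : PMap A B) : U.dom ⟶ A.obj := η U.dom ≫ eqToHom U.enl_dom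

instance (U : PMap A B) : Mono U.incl := by
  unfold incl; infer_instance

/-- Two partial maps are identified when their domains are isomorphic compatibly with the maximal
inclusions and with the morphisms to the codomain. -/
instance setoid (A B : ResObj C) : Setoid (PMap A B) where
  r U V := ∃ φ : U.dom ≅ V.dom, φ.hom ≫ V.incl = U.incl ∧ φ.hom ≫ V.hom = U.hom
  iseqv :=
    { refl := fun U => ⟨Iso.refl _, by simp, by simp⟩
      symm := by
        rintro U V ⟨φ, h₁, h₂⟩
        exact ⟨φ.symm, by simp [← h₁], by simp [← h₂]⟩
      trans := by
        rintro U V W ⟨φ, h₁, h₂⟩ ⟨ψ, k₁, k₂⟩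
        exact ⟨φ ≪≫ ψ, by simp [k₁, h₁], by simp [k₂, h₂]⟩ }

/-- `W` is a composite of `U` and `V` when its domain is a pullback of the inclusion of the domain
of `V` along the morphism of `U`, included in `A` through the domain of `U`. -/
def IsComp (U : PMap A B) (V : PMap B D) (W : PMap A D) : Prop :=
  ∃ (p : W.dom ⟶ V.dom) (m : W.dom ⟶ U.dom),
    IsPullback p m V.incl U.hom ∧ m ≫ U.incl = W.incl ∧ p ≫ V.hom = W.hom

lemma exists_isComp (U : PMap A B) (V : PMap B D) : ∃ W, IsComp U V W := by
  obtain ⟨P, p, m, h, hP, hm⟩ :=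
    LocalStructure.exists_isPullback (M := V.dom) (U.hom ≫ eqToHom V.enl_dom.symm)
  refine ⟨⟨P, h.trans U.enl_dom, p ≫ V.hom⟩, p, m, ?_, ?_, rfl⟩
  · refine IsPullback.of_iso hP (Iso.refl _) (Iso.refl _) (Iso.refl _) (eqToIso V.enl_dom)
      ?_ ?_ ?_ ?_ <;> simp [incl]
  · simp only [incl]
    rw [← Category.assoc, hm, Category.assoc, eqToHom_trans]

lemma IsComp.equiv {U U' : PMap A B} {V V' : PMap B D} {W W' : PMap A D} (h : IsComp U V W)
    (h' : IsComp U' V' W') (hU : U ≈ U') (hV : V ≈ V') : W ≈ W' := by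
  obtain ⟨p, m, hp, hi, hh⟩ := h
  obtain ⟨p', m', hp', hi', hh'⟩ := h'
  obtain ⟨φ, hφ₁, hφ₂⟩ := hU
  obtain ⟨ψ, hψ₁, hψ₂⟩ := hV
  have hp'' : IsPullback (p' ≫ ψ.inv) (m' ≫ φ.inv) V.incl U.hom := by
    refine IsPullback.of_iso hp' (Iso.refl _) ψ.symm φ.symm (Iso.refl _) ?_ ?_ ?_ ?_
    · simp
    · simp
    · simp [← hψ₁]
    · simp [← hφ₂]
  refine ⟨hp.isoIsPullback _ _ hp'', ?_, ?_⟩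
  · have e := hp.isoIsPullback_hom_snd _ _ hp''
    have e' := congrArg (fun x => x ≫ U.incl) e
    simp only [Category.assoc, ← hφ₁, Iso.inv_hom_id_assoc] at e'
    rw [← hi', e', hφ₁, hi]
  · have e := hp.isoIsPullback_hom_fst _ _ hp''
    have e' := congrArg (fun x => x ≫ V.hom) e
    simp only [Category.assoc, ← hψ₂, Iso.inv_hom_id_assoc] at e'
    rw [← hh', e', hψ₂, hh]

lemma IsComp.assoc {U : PMap A B} {V : PMap B D} {T : PMap D E} {W : PMap A D} {Y : PMap B E}
    {Z : PMap A E} (hW : IsComp U V W) (hZ : IsComp W T Z) (hY : IsComp V T Y) :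
    IsComp U Y Z := by
  obtain ⟨p₁, m₁, hp₁, hi₁, hh₁⟩ := hW
  obtain ⟨p, m, hp, hi, hh⟩ := hZ
  obtain ⟨p₂, m₂, hp₂, hi₂, hh₂⟩ := hY
  rw [← hh₁] at hp
  let q : Z.dom ⟶ Y.dom := hp₂.lift p (m ≫ p₁) (by rw [hp.w, Category.assoc])
  have hq₁ : q ≫ p₂ = p := hp₂.lift_fst _ _ _
  have hq₂ : q ≫ m₂ = m ≫ p₁ := hp₂.lift_snd _ _ _
  have hL : IsPullback q m m₂ p₁ := by
    refine IsPullback.of_right ?_ hq₂ hp₂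
    rwa [hq₁]
  refine ⟨q, m ≫ m₁, ?_, ?_, ?_⟩
  · rw [← hi₂]
    exact hL.paste_vert hp₁
  · rw [Category.assoc, hi₁, hi]
  · rw [← hh₂, ← Category.assoc, hq₁, hh]

/-- A morphism between total objects, regarded as an everywhere defined partial map. -/
def ofHom (f : A.obj ⟶ B.obj) : PMap A B := ⟨A.obj, A.total.1, f⟩

@[simp] lemma ofHom_incl (f : A.obj ⟶ B.obj) : (ofHom f).incl = 𝟙 A.obj := by
  obtain ⟨h, e⟩ := A.total
  change η A.obj ≫ eqToHom h = _
  rw [e, eqToHom_trans, eqToHom_refl]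

lemma isComp_ofHom (U : PMap A B) (f : B.obj ⟶ D.obj) :
    IsComp U (ofHom f) ⟨U.dom, U.enl_dom, U.hom ≫ f⟩ := by
  refine ⟨U.hom, 𝟙 _, ?_, Category.id_comp _, rfl⟩
  rw [ofHom_incl]
  exact IsPullback.of_id_snd

lemma isComp_ofHom_id (V : PMap A B) : IsComp (ofHom (𝟙 A.obj)) V V := by
  refine ⟨𝟙 _, V.incl, ?_, ?_, Category.id_comp _⟩
  · exact IsPullback.of_id_fst
  · rw [ofHom_incl]; exact Category.comp_id _

/-- The restriction of a partial map: the inclusion of its domain. -/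
def restr (U : PMap A B) : PMap A A := ⟨U.dom, U.enl_dom, U.incl⟩

end PMap

namespace ResObj

/-- Morphisms of the restriction category of a local category: isomorphism classes of partial
maps. -/
def Hom (A B : ResObj C) : Type u := Quotient (PMap.setoid A B)

/-- Composition, by pullback. -/
noncomputable def comp {A B D : ResObj C} : Hom A B → Hom B D → Hom A D :=
  Quotient.map₂ (fun U V => (PMap.exists_isComp U V).choose) fun _ _ hU _ _ hV =>
    (PMap.exists_isComp _ _).choose_spec.equiv (PMap.exists_isComp _ _).choose_spec hU hV

lemma comp_eq {A B D : ResObj C} {U : PMap A B} {V : PMap B D} {W : PMap A D}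
    (h : PMap.IsComp U V W) : comp (Quotient.mk _ U) (Quotient.mk _ V) = Quotient.mk _ W :=
  Quotient.sound ((PMap.exists_isComp U V).choose_spec.equiv h (Setoid.refl _) (Setoid.refl _))

noncomputable instance : Category (ResObj C) where
  Hom := Hom
  id A := Quotient.mk _ (PMap.ofHom (𝟙 A.obj))
  comp := comp
  id_comp := by
    rintro A B ⟨V⟩
    exact comp_eq (PMap.isComp_ofHom_id V)
  comp_id := by
    rintro A B ⟨U⟩
    refine (comp_eq (PMap.isComp_ofHom U (𝟙 B.obj))).trans ?_
    rw [Category.comp_id]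
    rfl
  assoc := by
    rintro A B D E ⟨U⟩ ⟨V⟩ ⟨T⟩
    obtain ⟨W, hW⟩ := PMap.exists_isComp U V
    obtain ⟨Y, hY⟩ := PMap.exists_isComp V T
    obtain ⟨Z, hZ⟩ := PMap.exists_isComp W T
    have e₁ := comp_eq hW
    have e₂ := comp_eq hY
    have e₃ := comp_eq hZ
    have e₄ := comp_eq (hW.assoc hZ hY)
    exact (congrArg (fun x => comp x (Quotient.mk _ T)) e₁).trans
      (e₃.trans (e₄.symm.trans (congrArg (fun x => comp (Quotient.mk _ U) x) e₂.symm)))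

end ResObj

/-- The morphism represented by a partial map. -/
def PMap.toHom {A B : ResObj C} (U : PMap A B) : A ⟶ B := Quotient.mk (PMap.setoid A B) U

lemma PMap.toHom_surjective {A B : ResObj C} (f : A ⟶ B) : ∃ U : PMap A B, U.toHom = f :=
  Quotient.exists_rep f

lemma PMap.toHom_eq_iff {A B : ResObj C} {U V : PMap A B} : U.toHom = V.toHom ↔ U ≈ V :=
  Quotient.eq

lemma PMap.IsComp.eq {A B D : ResObj C} {U : PMap A B} {V : PMap B D} {W : PMap A D}
    (h : PMap.IsComp U V W) : U.toHom ≫ V.toHom = W.toHom := ResObj.comp_eq h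

/-- The restriction idempotent of the class of `(U, f)` is the class of `(U, η U)`. -/
def ResObj.res {A B : ResObj C} : (A ⟶ B) → (A ⟶ A) :=
  Quotient.map PMap.restr fun _ _ ⟨φ, h, _⟩ => ⟨φ, h, h⟩

noncomputable instance : RestrictionStructure (ResObj C) where
  res := ResObj.res
  res_comp_self := by
    rintro A B f
    obtain ⟨U, rfl⟩ := PMap.toHom_surjective f
    refine PMap.IsComp.eq (U := U.restr) (V := U) ⟨𝟙 _, 𝟙 _, ?_, Category.id_comp _,
      Category.id_comp _⟩
    exact IsKernelPair.id_of_mono U.incl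
  res_comm := by
    rintro A B D f g
    obtain ⟨U, rfl⟩ := PMap.toHom_surjective f
    obtain ⟨V, rfl⟩ := PMap.toHom_surjective g
    obtain ⟨W, p, m, hp, hi, hh⟩ := PMap.exists_isComp U.restr V.restr
    refine (PMap.IsComp.eq ⟨p, m, hp, hi, hh⟩).trans
      (PMap.IsComp.eq (W := W) ⟨m, p, hp.flip, ?_, ?_⟩).symm
    · exact hp.w.trans hi
    · exact hp.w.symm.trans hh
  res_comp_res := by
    rintro A B D f g
    obtain ⟨U, rfl⟩ := PMap.toHom_surjective f
    obtain ⟨V, rfl⟩ := PMap.toHom_surjective g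
    obtain ⟨W, p, m, hp, hi, hh⟩ := PMap.exists_isComp V.restr U
    have e₁ : V.restr.toHom ≫ U.toHom = W.toHom := PMap.IsComp.eq ⟨p, m, hp, hi, hh⟩
    have e₂ : V.restr.toHom ≫ U.restr.toHom = W.restr.toHom :=
      PMap.IsComp.eq ⟨p, m, hp, hi, hp.w.trans hi⟩
    exact e₂.trans (congrArg ResObj.res e₁.symm)
  comp_res := by
    rintro A B D f g
    obtain ⟨U, rfl⟩ := PMap.toHom_surjective f
    obtain ⟨V, rfl⟩ := PMap.toHom_surjective g
    obtain ⟨W, p, m, hp, hi, hh⟩ := PMap.exists_isComp U V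
    have e₁ : U.toHom ≫ V.toHom = W.toHom := PMap.IsComp.eq ⟨p, m, hp, hi, hh⟩
    have e₂ : U.toHom ≫ V.restr.toHom = PMap.toHom ⟨W.dom, W.enl_dom, p ≫ V.incl⟩ :=
      PMap.IsComp.eq ⟨p, m, hp, hi, rfl⟩
    have e₃ : W.restr.toHom ≫ U.toHom = PMap.toHom ⟨W.dom, W.enl_dom, p ≫ V.incl⟩ := by
      refine PMap.IsComp.eq ⟨m, 𝟙 _, ?_, Category.id_comp _, hp.w.symm⟩
      change IsPullback m (𝟙 _) U.incl W.incl
      rw [← hi]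
      simpa using (IsPullback.of_id_snd (f := m)).paste_horiz (IsKernelPair.id_of_mono U.incl)
    exact e₂.trans (e₃.symm.trans (congrArg (fun x => ResObj.res x ≫ U.toHom) e₁.symm))

end Res

section ResFunctor

variable {C D : Type u} [Category.{u} C] [Category.{u} D] [LocalStructure C] [LocalStructure D]

/-- The image of a total object under a local functor. -/
def LocalFunctor.mapResObj (F : LocalFunctor C D) (A : ResObj C) : ResObj D :=
  ⟨F.obj A.obj, F.map_isTotalObj A.total⟩

/-- The image `(F U, F f)` of a partial map `(U, f)` under a local functor. -/
def LocalFunctor.mapPMap (F : LocalFunctor C D) {A B : ResObj C} (U : PMap A B) :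
    PMap (F.mapResObj A) (F.mapResObj B) :=
  ⟨F.obj U.dom, (F.map_enl U.dom).symm.trans (congrArg F.obj U.enl_dom), F.map U.hom⟩

lemma LocalFunctor.mapPMap_incl (F : LocalFunctor C D) {A B : ResObj C} (U : PMap A B) :
    (F.mapPMap U).incl = F.map U.incl := by
  change η (F.obj U.dom) ≫ eqToHom _ = F.map (η U.dom ≫ eqToHom U.enl_dom)
  rw [F.map_comp, F.map_η, eqToHom_map, Category.assoc, eqToHom_trans]

lemma LocalFunctor.mapPMap_equiv (F : LocalFunctor C D) {A B : ResObj C} {U V : PMap A B}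
    (h : U ≈ V) : F.mapPMap U ≈ F.mapPMap V := by
  obtain ⟨φ, h₁, h₂⟩ := h
  refine ⟨F.mapIso φ, ?_, ?_⟩
  · rw [F.mapPMap_incl, F.mapPMap_incl, ← h₁, F.map_comp]
    rfl
  · change F.map φ.hom ≫ F.map V.hom = F.map U.hom
    rw [← F.map_comp, h₂]

lemma LocalFunctor.mapPMap_isComp (F : LocalFunctor C D) {A B E : ResObj C} {U : PMap A B}
    {V : PMap B E} {W : PMap A E} (h : PMap.IsComp U V W) :
    PMap.IsComp (F.mapPMap U) (F.mapPMap V) (F.mapPMap W) := by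
  obtain ⟨p, m, hp, hi, hh⟩ := h
  refine ⟨F.map p, F.map m, ?_, ?_, ?_⟩
  · rw [F.mapPMap_incl]
    have h₁ : IsPullback p m (η V.dom) (U.hom ≫ eqToHom V.enl_dom.symm) := by
      refine IsPullback.of_iso hp (Iso.refl _) (Iso.refl _) (Iso.refl _)
        (eqToIso V.enl_dom.symm) ?_ ?_ ?_ ?_ <;> simp [PMap.incl]
    refine IsPullback.of_iso (F.map_isPullback h₁) (Iso.refl _) (Iso.refl _) (Iso.refl _)
      (F.mapIso (eqToIso V.enl_dom)) ?_ ?_ ?_ ?_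
    · exact (Category.comp_id _).trans (Category.id_comp _).symm
    · exact (Category.comp_id _).trans (Category.id_comp _).symm
    · change F.map (η V.dom) ≫ F.map (eqToHom V.enl_dom) = 𝟙 _ ≫ F.map V.incl
      rw [Category.id_comp, ← F.map_comp]
      rfl
    · change F.map (U.hom ≫ eqToHom V.enl_dom.symm) ≫ F.map (eqToHom V.enl_dom) =
        𝟙 _ ≫ F.map U.hom
      rw [← F.map_comp]
      simp
  · rw [F.mapPMap_incl, F.mapPMap_incl, ← hi, F.map_comp]
    rfl
  · change F.map p ≫ F.map V.hom = F.map W.hom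
    rw [← hh, F.map_comp]

/-- The restriction functor induced by a local functor: `(U, f) ↦ (F U, F f)`. -/
noncomputable def LocalFunctor.resF (F : LocalFunctor C D) :
    RestrictionFunctor (ResObj C) (ResObj D) where
  obj A := F.mapResObj A
  map := Quotient.map F.mapPMap fun _ _ h => F.mapPMap_equiv h
  map_id A := by
    change PMap.toHom (F.mapPMap (PMap.ofHom (𝟙 A.obj))) = PMap.toHom (PMap.ofHom (𝟙 (F.obj A.obj)))
    unfold LocalFunctor.mapPMap PMap.ofHom
    simp only [F.map_id]
    rfl
  map_comp {A B E} f g := by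
    obtain ⟨U, rfl⟩ := PMap.toHom_surjective f
    obtain ⟨V, rfl⟩ := PMap.toHom_surjective g
    obtain ⟨W, hW⟩ := PMap.exists_isComp U V
    rw [hW.eq]
    exact (F.mapPMap_isComp hW).eq.symm
  map_res {A B} f := by
    obtain ⟨U, rfl⟩ := PMap.toHom_surjective f
    change PMap.toHom (F.mapPMap U.restr) = PMap.toHom (F.mapPMap U).restr
    unfold PMap.restr
    rw [F.mapPMap_incl]
    rfl

/-- The total natural transformation induced by a total natural transformation of local functors;
its component at `M` is the class of `(F M, φ_M)`. -/
noncomputable def TotalLocalTrans.resT {F G : LocalFunctor C D} (φ : TotalLocalTrans F G) :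
    TotalTrans F.resF G.resF where
  nat :=
    { app A := PMap.toHom (A := F.mapResObj A) (B := G.mapResObj A)
        (PMap.ofHom (φ.nat.app A.obj))
      naturality A B f := by
        obtain ⟨U, rfl⟩ := PMap.toHom_surjective f
        change (F.mapPMap U).toHom ≫ PMap.toHom (A := F.mapResObj B) (B := G.mapResObj B)
            (PMap.ofHom (φ.nat.app B.obj)) =
          PMap.toHom (A := F.mapResObj A) (B := G.mapResObj A)
            (PMap.ofHom (φ.nat.app A.obj)) ≫ (G.mapPMap U).toHom
        refine (PMap.isComp_ofHom (D := G.mapResObj B) (F.mapPMap U) (φ.nat.app B.obj)).eq.trans ?_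
        refine (PMap.IsComp.eq ⟨φ.nat.app U.dom, (F.mapPMap U).incl, ?_, ?_, ?_⟩).symm
        · change IsPullback (φ.nat.app U.dom) (F.mapPMap U).incl (G.mapPMap U).incl
            (φ.nat.app A.obj)
          rw [F.mapPMap_incl, G.mapPMap_incl]
          refine IsPullback.of_iso (φ.total U.dom) (Iso.refl _) (Iso.refl _)
            (F.mapIso (eqToIso U.enl_dom)) (G.mapIso (eqToIso U.enl_dom)) ?_ ?_ ?_ ?_
          · simp
          · change F.map (η U.dom) ≫ F.map (eqToHom U.enl_dom) = 𝟙 _ ≫ F.map U.incl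
            rw [Category.id_comp, ← F.map_comp]
            rfl
          · change G.map (η U.dom) ≫ G.map (eqToHom U.enl_dom) = 𝟙 _ ≫ G.map U.incl
            rw [Category.id_comp, ← G.map_comp]
            rfl
          · exact (φ.nat.naturality (eqToHom U.enl_dom)).symm
        · exact (congrArg (fun x => (F.mapPMap U).incl ≫ x)
            (PMap.ofHom_incl (A := F.mapResObj A) (B := G.mapResObj A)
              (φ.nat.app A.obj))).trans (Category.comp_id _)
        · exact (φ.nat.naturality U.hom).symm }
  total A := by
    change PMap.toHom (PMap.restr (A := F.mapResObj A) (B := G.mapResObj A)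
        (PMap.ofHom (φ.nat.app A.obj))) =
      PMap.toHom (A := F.mapResObj A) (B := F.mapResObj A) (PMap.ofHom (𝟙 (F.obj A.obj)))
    unfold PMap.restr
    rw [PMap.ofHom_incl (A := F.mapResObj A) (B := G.mapResObj A) (φ.nat.app A.obj)]
    rfl

end ResFunctor

/-- The restriction category of a local category. -/
noncomputable def LCat.res (C : LCat.{u}) : RCat.{u} := ⟨ResObj C.carrier⟩

/-- The 2-functor from local categories to restriction categories on 1-cells. -/
noncomputable def LCat.resMap {C D : LCat.{u}} (F : C ⟶ D) : C.res ⟶ D.res :=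
  LocalFunctor.resF F

/-- The 2-functor from local categories to restriction categories on 2-cells. -/
noncomputable def LCat.resMap₂ {C D : LCat.{u}} {F G : C ⟶ D} (φ : F ⟶ G) :
    LCat.resMap F ⟶ LCat.resMap G :=
  TotalLocalTrans.resT φ

/-- The 2-functor from local categories to restriction categories. -/
noncomputable def resFunctor : StrictPseudofunctor LCat.{u} RCat.{u} :=
  StrictPseudofunctor.mk''
    { obj := LCat.res
      map := LCat.resMap
      map₂ := LCat.resMap₂
      map₂_id := fun {X Y} F => RCat.hom₂_ext fun A => rfl
      map₂_comp := fun {X Y F G H} φ ψ => RCat.hom₂_ext fun A =>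
        (PMap.isComp_ofHom (A := F.mapResObj A) (B := G.mapResObj A) (D := H.mapResObj A)
          (PMap.ofHom (φ.nat.app A.obj)) (ψ.nat.app A.obj)).eq.symm
      map_id := fun C => RestrictionFunctor.ext' (CategoryTheory.Functor.hext (fun _ => rfl) (by
        intro A B f
        obtain ⟨U, rfl⟩ := PMap.toHom_surjective f
        rfl))
      map_comp := fun F G => RestrictionFunctor.ext' (CategoryTheory.Functor.hext (fun _ => rfl) (by
        intro A B f
        obtain ⟨U, rfl⟩ := PMap.toHom_surjective f
        rfl))
      map₂_whisker_left := fun F _ _ φ => RCat.eq_eqToHom_comp _ _ fun A => HEq.rfl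
      map₂_whisker_right := fun {X Y Z F F'} φ G => RCat.eq_eqToHom_comp _ _ fun A => HEq.rfl }

/-! ### 2-equivalences -/

section TwoEquivalence

variable {B C : Type (u + 1)} [Bicategory.{u, u} B] [Bicategory.{u, u} C]

/-- A 2-natural transformation between 2-functors: 1-cells which are strictly natural with respect
to 1-cells and 2-cells. -/
structure TwoNatTrans (F G : StrictPseudofunctor B C) where
  app : ∀ a : B, F.obj a ⟶ G.obj a
  naturality : ∀ {a b : B} (f : a ⟶ b), F.map f ≫ app b = app a ≫ G.map f
  naturality₂ : ∀ {a b : B} {f g : a ⟶ b} (θ : f ⟶ g),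
    F.map₂ θ ▷ app b =
      eqToHom (naturality f) ≫ app a ◁ G.map₂ θ ≫ eqToHom (naturality g).symm

/-- A 1-cell is an equivalence when it underlies an internal equivalence. -/
def IsEquivalenceOneCell {a b : B} (f : a ⟶ b) : Prop := ∃ e : a ≌ b, e.hom = f

/-- A 1-cell is an isomorphism when it has a strict inverse. -/
def IsIsoOneCell {a b : B} (f : a ⟶ b) : Prop := ∃ g : b ⟶ a, f ≫ g = 𝟙 a ∧ g ≫ f = 𝟙 b

/-- Two 2-functors `F : B ⥤ C` and `G : C ⥤ B` form a 2-equivalence, as witnessed by 2-natural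
transformations `N : 𝟭 B ⟶ F ⋙ G` and `E : 𝟭 C ⟶ G ⋙ F`, when all components of `N` and `E` are
equivalences, and the triangle identities hold strictly.  (Since `E` points in the direction of an
inverse counit, the triangle identities read `F N = E F` and `G E = N G`.) -/
structure IsTwoEquivalence (F : StrictPseudofunctor B C) (G : StrictPseudofunctor C B)
    (N : TwoNatTrans (StrictPseudofunctor.id B) (F.comp G))
    (E : TwoNatTrans (StrictPseudofunctor.id C) (G.comp F)) : Prop where
  unit_equivalence : ∀ b : B, IsEquivalenceOneCell (N.app b)
  counit_equivalence : ∀ c : C, IsEquivalenceOneCell (E.app c)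
  triangle_left : ∀ b : B, F.map (N.app b) = E.app (F.obj b)
  triangle_right : ∀ c : C, G.map (E.app c) = N.app (G.obj c)

/-- The full sub-2-category spanned by the objects satisfying a property. -/
abbrev FullSub (P : B → Prop) : Type (u + 1) :=
  InducedBicategory B (Subtype.val : {b : B // P b} → B)

/-- Equality of 2-cells in a full sub-2-category can be checked in the ambient 2-category. -/
lemma FullSub.eq_eqToHom_comp {P : B → Prop} {X Y : FullSub P} {f g f' g' : X ⟶ Y}
    (hf : f = f') (hg : g' = g) {θ : f ⟶ g} {κ : f' ⟶ g'}
    (h : θ.hom = eqToHom (congrArg InducedBicategory.Hom.hom hf) ≫ κ.hom ≫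
      eqToHom (congrArg InducedBicategory.Hom.hom hg)) :
    θ = eqToHom hf ≫ κ ≫ eqToHom hg := by
  subst hf hg
  apply InducedBicategory.hom₂_ext
  simpa using h

instance [Bicategory.Strict B] (P : B → Prop) : Bicategory.Strict (FullSub P) where
  id_comp f := InducedBicategory.hom_ext (Bicategory.Strict.id_comp f.hom)
  comp_id f := InducedBicategory.hom_ext (Bicategory.Strict.comp_id f.hom)
  assoc f g h := InducedBicategory.hom_ext (Bicategory.Strict.assoc f.hom g.hom h.hom)
  leftUnitor_eqToIso f := by
    ext
    simp [Bicategory.Strict.leftUnitor_eqToIso]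
  rightUnitor_eqToIso f := by
    ext
    simp [Bicategory.Strict.rightUnitor_eqToIso]
  associator_eqToIso f g h := by
    ext
    simp [Bicategory.Strict.associator_eqToIso]

variable [Bicategory.Strict B] [Bicategory.Strict C] {P : B → Prop} {Q : C → Prop}

/-- The restriction of a 2-functor to full sub-2-categories. -/
def restrictFunctor (F : StrictPseudofunctor B C) (h : ∀ b, P b → Q (F.obj b)) :
    StrictPseudofunctor (FullSub P) (FullSub Q) :=
  StrictPseudofunctor.mk''
    { obj := fun b => (⟨F.obj b.1, h b.1 b.2⟩ : {c : C // Q c})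
      map := fun f => InducedBicategory.mkHom (F.map f.hom)
      map₂ := fun θ => InducedBicategory.mkHom₂ (F.map₂ θ.hom)
      map₂_id := fun f => InducedBicategory.hom₂_ext (F.map₂_id f.hom)
      map₂_comp := fun θ κ => InducedBicategory.hom₂_ext (F.map₂_comp θ.hom κ.hom)
      map_id := fun b => InducedBicategory.hom_ext (F.map_id b.1)
      map_comp := fun f g => InducedBicategory.hom_ext (F.map_comp f.hom g.hom)
      map₂_whisker_left := fun f _ _ θ => FullSub.eq_eqToHom_comp _ _ (by
        have h := F.map₂_whisker_left f.hom θ.hom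
        rw [F.mapComp_eq_eqToIso, F.mapComp_eq_eqToIso] at h
        exact h)
      map₂_whisker_right := fun θ g => FullSub.eq_eqToHom_comp _ _ (by
        have h := F.map₂_whisker_right θ.hom g.hom
        rw [F.mapComp_eq_eqToIso, F.mapComp_eq_eqToIso] at h
        exact h) }

/-- The restriction of a 2-natural transformation to full sub-2-categories. -/
def restrictTrans (F : StrictPseudofunctor B C) (G : StrictPseudofunctor C B)
    (hF : ∀ b, P b → Q (F.obj b)) (hG : ∀ c, Q c → P (G.obj c))
    (N : TwoNatTrans (StrictPseudofunctor.id B) (F.comp G)) :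
    TwoNatTrans (StrictPseudofunctor.id (FullSub P))
      ((restrictFunctor F hF).comp (restrictFunctor G hG)) where
  app b := InducedBicategory.mkHom (N.app b.1)
  naturality f := InducedBicategory.hom_ext (N.naturality f.hom)
  naturality₂ θ := FullSub.eq_eqToHom_comp _ _ (N.naturality₂ θ.hom)

end TwoEquivalence

/-! ### The comparison functors -/

/-- The comparison functor from a restriction category `X` to the restriction category of its local
category: `A ↦ (A, 𝟙 A)`, and `f : A ⟶ B` is sent to the class of `f : (A, res f) ⟶ (B, 𝟙 B)`. -/
def toResLoc (X : Type u) [Category.{u} X] [RestrictionStructure X] : X ⥤ ResObj (LocObj X) where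
  obj A := ⟨⟨A, 𝟙 A, res_id A⟩, rfl, rfl⟩
  map {A B} f := PMap.toHom ⟨⟨A, res f, res_res f⟩, rfl, ⟨f, rfl, Category.comp_id f⟩⟩
  map_id A := by
    have key : ∀ (e : A ⟶ A) (he : res e = e) (h : res (𝟙 A) = e), e = 𝟙 A →
        PMap.toHom (A := (⟨⟨A, 𝟙 A, res_id A⟩, rfl, rfl⟩ : ResObj (LocObj X)))
          (B := (⟨⟨A, 𝟙 A, res_id A⟩, rfl, rfl⟩ : ResObj (LocObj X)))
          ⟨⟨A, e, he⟩, rfl, ⟨𝟙 A, h, Category.comp_id _⟩⟩ = 𝟙 _ := by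
      intro e he h heq
      subst heq
      rfl
    exact key _ _ rfl (res_id A)
  map_comp {A B D} f g := by
    symm
    apply PMap.IsComp.eq
    have h₁ : res (f ≫ res g) = res (f ≫ g) := (res_comp_eq f g).symm
    have h₂ : res (f ≫ g) ≫ res f = res (f ≫ g) := by
      rw [RestrictionStructure.res_comm, RestrictionStructure.res_comp_res,
        ← Category.assoc, RestrictionStructure.res_comp_self]
    refine ⟨⟨f ≫ res g, h₁, by rw [Category.assoc, res_idem]⟩,
      ⟨res (f ≫ g), res_res _, h₂⟩, ?_, ?_, ?_⟩
    · exact LocObj.isPullback_of _ _ _ _ (Category.comp_id _) rfl rfl h₁.symm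
    · apply LocObj.hom_ext
      change res (f ≫ g) ≫ res f ≫ 𝟙 A = res (f ≫ g) ≫ 𝟙 A
      rw [Category.comp_id, Category.comp_id, h₂]
    · apply LocObj.hom_ext
      change (f ≫ res g) ≫ g = f ≫ g
      rw [Category.assoc, RestrictionStructure.res_comp_self]

section

variable {C : Type u} [Category.{u} C] [LocalStructure C]

/-- The partial map `(M, f)` on the total object `enl M`. -/
def PMap.ofLocal (M : C) {B : ResObj C} (f : M ⟶ B.obj) : PMap ⟨enl M, isTotalObj_enl M⟩ B :=
  ⟨M, rfl, f⟩

lemma PMap.ofLocal_incl (M : C) {B : ResObj C} (f : M ⟶ B.obj) :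
    (PMap.ofLocal M f).incl = η M := Category.comp_id _

lemma PMap.isComp_ofLocal {M N : C} {B : ResObj C} (f : M ⟶ N) (g : N ⟶ B.obj) :
    PMap.IsComp (PMap.ofLocal M (B := ⟨enl N, isTotalObj_enl N⟩) (f ≫ η N)) (PMap.ofLocal N g)
      (PMap.ofLocal M (f ≫ g)) := by
  refine ⟨f, 𝟙 M, ?_, ?_, rfl⟩
  · rw [PMap.ofLocal_incl]
    change IsPullback f (𝟙 M) (η N) (f ≫ η N)
    simpa using (IsPullback.of_id_snd (f := f)).paste_horiz (IsKernelPair.id_of_mono (η N))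
  · rw [PMap.ofLocal_incl, PMap.ofLocal_incl]
    exact Category.id_comp _

lemma PMap.res_ofLocal (M : C) {B : ResObj C} (f : M ⟶ B.obj) :
    res (PMap.ofLocal M f).toHom =
      (PMap.ofLocal M (B := ⟨enl M, isTotalObj_enl M⟩) (η M)).toHom := by
  change PMap.toHom (PMap.ofLocal M f).restr = _
  unfold PMap.restr
  rw [PMap.ofLocal_incl]
  rfl

end

/-- The comparison functor from a local category `C` to the local category of its restriction
category: `M` is sent to the total object `enl M` together with the class of `(M, η M)`, and
`f : M ⟶ N` is sent to the class of `(M, f ≫ η N)`. -/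
noncomputable def toLocRes (C : Type u) [Category.{u} C] [LocalStructure C] :
    C ⥤ LocObj (ResObj C) where
  obj M :=
    { base := ⟨enl M, isTotalObj_enl M⟩
      idem := (PMap.ofLocal M (η M)).toHom
      res_idem := PMap.res_ofLocal M (B := ⟨enl M, isTotalObj_enl M⟩) (η M) }
  map {M N} f :=
    { hom := (PMap.ofLocal M (f ≫ η N)).toHom
      res_hom := PMap.res_ofLocal M (B := ⟨enl N, isTotalObj_enl N⟩) (f ≫ η N)
      hom_idem := (PMap.isComp_ofLocal (B := ⟨enl N, isTotalObj_enl N⟩) f (η N)).eq }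
  map_id M := by
    apply LocObj.hom_ext
    change (PMap.ofLocal M (B := ⟨enl M, isTotalObj_enl M⟩) (𝟙 M ≫ η M)).toHom =
      (PMap.ofLocal M (B := ⟨enl M, isTotalObj_enl M⟩) (η M)).toHom
    rw [Category.id_comp]
  map_comp {M N K} f g := by
    apply LocObj.hom_ext
    change (PMap.ofLocal M (B := ⟨enl K, isTotalObj_enl K⟩) ((f ≫ g) ≫ η K)).toHom = _
    rw [Category.assoc]
    exact (PMap.isComp_ofLocal (B := ⟨enl K, isTotalObj_enl K⟩) f (g ≫ η K)).eq.symm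

/-! ### Split restriction categories and split local categories -/

/-- A restriction category is split when all its restriction idempotents split. -/
def RCat.IsSplit (X : RCat.{u}) : Prop :=
  ∀ (A : X.carrier) (e : A ⟶ A), res e = e →
    ∃ (E : X.carrier) (s : E ⟶ A) (r : A ⟶ E), s ≫ r = 𝟙 E ∧ r ≫ s = e

/-- A local category is split when all its objects are isomorphic to total objects. -/
def LCat.IsSplit (C : LCat.{u}) : Prop := ∀ M : C.carrier, ObjSplits M

/-- The 2-category of split restriction categories. -/
abbrev SRCat : Type (u + 1) := FullSub RCat.IsSplit.{u}

/-- The 2-category of split local categories. -/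
abbrev SLCat : Type (u + 1) := FullSub LCat.IsSplit.{u}

end Partiality

open Partiality

namespace Partiality

open Partiality.RestrictionStructure (res)
open Partiality.LocalStructure (enl η)

/-! ### Equality of objects and heterogeneous equality of morphisms -/

/-! Both comparisons are fully faithful and strictly surjective on objects; the difference between
them is injectivity on objects.

For `N`: a total object of the local category of `X` is an `(A, 𝟙 A)`, so objects correspond
bijectively. A partial map out of it has a domain `(A, d)` and a morphism `f` with `res f = d`, so
the domain is determined by `f`. An isomorphism of representatives forces the two underlying
morphisms to be equal. Hence `N` is bijective on objects and on hom-sets, and its inverse preserves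
restrictions (`RCat.isIsoOneCell_of_fullyFaithful`).

For `E`: faithfulness is monicity of the maximal inclusions. For fullness, a morphism `(enl M, [M, η
M]) ⟶ (enl N, [N, η N])` is a class `[U, f]`. The condition on its restriction identifies `U` with
`M` over `enl M`, and absorption of `[N, η N]` makes `f` factor through `η N`. A restriction
idempotent on a total object is some `[U, η U]`, which gives surjectivity on objects. Objects
isomorphic over the same enlargement have the same image, so in general only an equivalence results.
Its inverse must preserve `enl` strictly, so the section on objects is chosen with care
(`toLocResSection`); preservation of `η` and of pullbacks is then automatic
(`LCat.isEquivalenceOneCell_of_fullyFaithful`).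

Naturality and the triangle identities are equalities of functors whose values on objects agree only
propositionally. They are checked with `HEq` on explicit representatives, by `toResLoc_map_heq` and
`toLocRes_map_heq`. The split case follows because full sub-2-categories contain all 1-cells and
2-cells between their objects. -/

lemma ResObj.ext_obj {C : Type u} [Category.{u} C] [LocalStructure C] {A B : ResObj C}
    (h : A.obj = B.obj) : A = B := by
  cases A; cases B; cases h; rfl

lemma LocObj.ext_heq {X : Type u} [Category.{u} X] [RestrictionStructure X] {A B : LocObj X}
    (h : A.base = B.base) (h' : HEq A.idem B.idem) : A = B := by
  cases A; cases B; cases h; cases h'; rfl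

lemma LocObj.hom_heq {X : Type u} [Category.{u} X] [RestrictionStructure X] {A A' B B' : LocObj X}
    (hA : A = A') (hB : B = B') {f : A ⟶ B} {g : A' ⟶ B'} (h : HEq f.hom g.hom) : HEq f g := by
  subst hA hB
  exact heq_of_eq (LocObj.hom_ext (eq_of_heq h))

/-- Representatives are compared on the nose, not up to isomorphism of domains. This suffices below,
where the classes to be compared come with explicit representatives. -/
lemma PMap.toHom_heq {C : Type u} [Category.{u} C] [LocalStructure C] {A A' B B' : ResObj C}
    (hA : A = A') (hB : B = B') {U : PMap A B} {V : PMap A' B'} (hd : U.dom = V.dom)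
    (hh : HEq U.hom V.hom) : HEq U.toHom V.toHom := by
  subst hA hB
  obtain ⟨M, hM, f⟩ := U
  obtain ⟨N, hN, g⟩ := V
  obtain rfl : M = N := hd
  obtain rfl : f = g := eq_of_heq hh
  rfl

/-! ### Equivalences and isomorphisms of 1-cells -/

lemma IsIsoOneCell.isEquivalenceOneCell {B : Type (u + 1)} [Bicategory.{u, u} B] {a b : B}
    {f : a ⟶ b} (h : IsIsoOneCell f) : IsEquivalenceOneCell f := by
  obtain ⟨g, h₁, h₂⟩ := h
  -- The counit is corrected by adjointification, so no triangle law has to be checked for the two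
  -- transports.
  exact ⟨Equivalence.mkOfAdjointifyCounit (eqToIso h₁.symm) (eqToIso h₂), rfl⟩

/-- Fullness on 1-cells and 2-cells puts the ambient inverse, unit and counit inside the
sub-2-category. -/
lemma FullSub.isEquivalenceOneCell {B : Type (u + 1)} [Bicategory.{u, u} B] {P : B → Prop}
    {a b : FullSub P} {f : a ⟶ b} (h : IsEquivalenceOneCell f.hom) : IsEquivalenceOneCell f := by
  obtain ⟨e, he⟩ := h
  have i₁ : 𝟙 a.1 ≅ f.hom ≫ e.inv := he ▸ e.unit
  have i₂ : e.inv ≫ f.hom ≅ 𝟙 b.1 := he ▸ e.counit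
  exact ⟨Equivalence.mkOfAdjointifyCounit (f := f) (g := InducedBicategory.mkHom e.inv)
    (InducedBicategory.isoMk i₁) (InducedBicategory.isoMk i₂), rfl⟩

lemma FullSub.isIsoOneCell {B : Type (u + 1)} [Bicategory.{u, u} B] {P : B → Prop}
    {a b : FullSub P} {f : a ⟶ b} (h : IsIsoOneCell f.hom) : IsIsoOneCell f := by
  obtain ⟨g, h₁, h₂⟩ := h
  exact ⟨InducedBicategory.mkHom g, InducedBicategory.hom_ext h₁, InducedBicategory.hom_ext h₂⟩

/-- A 2-equivalence restricts to full sub-2-categories which are preserved by both 2-functors. -/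
lemma IsTwoEquivalence.restrict {B C : Type (u + 1)} [Bicategory.{u, u} B] [Bicategory.{u, u} C]
    [Bicategory.Strict B] [Bicategory.Strict C] {P : B → Prop} {Q : C → Prop}
    {F : StrictPseudofunctor B C} {G : StrictPseudofunctor C B}
    {N : TwoNatTrans (StrictPseudofunctor.id B) (F.comp G)}
    {E : TwoNatTrans (StrictPseudofunctor.id C) (G.comp F)}
    (h : IsTwoEquivalence F G N E)
    (hF : ∀ b, P b → Q (F.obj b)) (hG : ∀ c, Q c → P (G.obj c)) :
    IsTwoEquivalence (B := FullSub P) (C := FullSub Q) (restrictFunctor F hF)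
      (restrictFunctor G hG) (restrictTrans F G hF hG N) (restrictTrans G F hG hF E) where
  unit_equivalence b := FullSub.isEquivalenceOneCell (h.unit_equivalence b.1)
  counit_equivalence c := FullSub.isEquivalenceOneCell (h.counit_equivalence c.1)
  triangle_left b := InducedBicategory.hom_ext (h.triangle_left b.1)
  triangle_right c := InducedBicategory.hom_ext (h.triangle_right c.1)

/-! ### Sections of fully faithful functors -/

section FullyFaithful

variable {C D : Type u} [Category.{u} C] [Category.{u} D]

/-- The functor which is inverse to a fully faithful functor `F` up to a section of `F` on
objects. -/
noncomputable def sectionFunctor (F : C ⥤ D) [F.Full] [F.Faithful] (s : D → C)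
    (hs : ∀ X, F.obj (s X) = X) : D ⥤ C where
  obj := s
  map f := F.preimage (eqToHom (hs _) ≫ f ≫ eqToHom (hs _).symm)
  map_id X := F.map_injective (by simp)
  map_comp f g := F.map_injective (by simp)

variable (F : C ⥤ D) [F.Full] [F.Faithful] (s : D → C) (hs : ∀ X, F.obj (s X) = X)

lemma map_sectionFunctor_map {X Y : D} (f : X ⟶ Y) :
    F.map ((sectionFunctor F s hs).map f) = eqToHom (hs X) ≫ f ≫ eqToHom (hs Y).symm :=
  F.map_preimage _

lemma sectionFunctor_comp : sectionFunctor F s hs ⋙ F = 𝟭 D :=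
  CategoryTheory.Functor.ext hs fun _ _ f => map_sectionFunctor_map F s hs f

/-- When `s` is a two-sided inverse on objects, the functor is a strict inverse. By faithfulness it
is enough to compare images under `F`, where both sides are `F.map f` transported along equalities
of objects. -/
lemma comp_sectionFunctor (hs' : ∀ M, s (F.obj M) = M) : F ⋙ sectionFunctor F s hs = 𝟭 C :=
  CategoryTheory.Functor.ext hs' fun M N f => F.map_injective (by
    refine (map_sectionFunctor_map F s hs (F.map f)).trans ?_
    have key : F.map (eqToHom (hs' M) ≫ f ≫ eqToHom (hs' N).symm) =
        eqToHom (hs (F.obj M)) ≫ F.map f ≫ eqToHom (hs (F.obj N)).symm := by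
      simp [eqToHom_map]
    exact key.symm)

/-- The identity functor is isomorphic to the composite of a fully faithful functor with its
section. -/
noncomputable def sectionFunctorUnit : 𝟭 C ≅ F ⋙ sectionFunctor F s hs :=
  NatIso.ofComponents (fun M => F.preimageIso (eqToIso (hs (F.obj M)).symm))
    fun {M N} f => F.map_injective (by
      have key : F.map f ≫ eqToHom (hs (F.obj N)).symm = eqToHom (hs (F.obj M)).symm ≫
          eqToHom (hs (F.obj M)) ≫ F.map f ≫ eqToHom (hs (F.obj N)).symm := by simp
      refine (F.map_comp _ _).trans (Eq.trans ?_ (F.map_comp _ _).symm)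
      refine Eq.trans ?_ (congrArg (fun x => F.map _ ≫ x)
        (map_sectionFunctor_map F s hs (F.map f))).symm
      simp only [Functor.preimageIso_hom, Functor.map_preimage]
      exact key)

include hs in
lemma isEquivalence_of_section : F.IsEquivalence where
  essSurj := ⟨fun X => ⟨s X, ⟨eqToIso (hs X)⟩⟩⟩

/-- Two out of three, since `F` and the composite with `F` are equivalences. The purpose is that the
section functor preserves pullbacks. -/
lemma sectionFunctor_isEquivalence : (sectionFunctor F s hs).IsEquivalence := by
  have := isEquivalence_of_section F s hs
  have : (sectionFunctor F s hs ⋙ F).IsEquivalence := by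
    rw [sectionFunctor_comp]; infer_instance
  exact Functor.isEquivalence_of_comp_right _ F

end FullyFaithful

/-- A fully faithful restriction functor which is bijective on objects is an isomorphism. -/
lemma RCat.isIsoOneCell_of_fullyFaithful {X Y : RCat.{u}} (F : X ⟶ Y)
    [(RestrictionFunctor.toFunctor F).Full] [(RestrictionFunctor.toFunctor F).Faithful]
    (s : Y.carrier → X.carrier) (hs : ∀ A, (RestrictionFunctor.toFunctor F).obj (s A) = A)
    (hs' : ∀ A, s ((RestrictionFunctor.toFunctor F).obj A) = A) : IsIsoOneCell F := by
  let G : Y ⟶ X :=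
    { sectionFunctor F.toFunctor s hs with
      map_res := fun {A B} f => F.toFunctor.map_injective (by
        -- Restriction commutes with transport along equalities of objects; applying the faithful
        -- `F` reduces the claim to this.
        have key : ∀ {A A' B B' : Y.carrier} (hA : A = A') (hB : B = B') (f : A' ⟶ B'),
            eqToHom hA ≫ res f ≫ eqToHom hA.symm = res (eqToHom hA ≫ f ≫ eqToHom hB.symm) := by
          intro A A' B B' hA hB f
          subst hA hB
          simp
        change F.map ((sectionFunctor F.toFunctor s hs).map (res f)) =
          F.map (res ((sectionFunctor F.toFunctor s hs).map f))
        rw [F.map_res, map_sectionFunctor_map, map_sectionFunctor_map]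
        exact key (hs A) (hs B) f) }
  exact ⟨G, RestrictionFunctor.ext' (comp_sectionFunctor F.toFunctor s hs hs'),
    RestrictionFunctor.ext' (sectionFunctor_comp F.toFunctor s hs)⟩

/-- A natural isomorphism of local functors is an invertible 2-cell. -/
def LCat.isoOfNatIso {C D : LCat.{u}} {F G : C ⟶ D}
    (e : LocalFunctor.toFunctor F ≅ LocalFunctor.toFunctor G) : F ≅ G where
  -- A naturality square with invertible horizontal sides is always a pullback, so totality is no
  -- extra condition here.
  hom := ⟨e.hom, fun _ => IsPullback.of_horiz_isIso ⟨(e.hom.naturality _).symm⟩⟩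
  inv := ⟨e.inv, fun _ => IsPullback.of_horiz_isIso ⟨(e.inv.naturality _).symm⟩⟩
  hom_inv_id := LCat.hom₂_ext fun M => e.hom_inv_id_app M
  inv_hom_id := LCat.hom₂_ext fun M => e.inv_hom_id_app M

/-- A fully faithful local functor with a section on objects which preserves enlargements is an
equivalence. -/
lemma LCat.isEquivalenceOneCell_of_fullyFaithful {C D : LCat.{u}} (F : C ⟶ D)
    [(LocalFunctor.toFunctor F).Full] [(LocalFunctor.toFunctor F).Faithful]
    (s : D.carrier → C.carrier) (hs : ∀ M, (LocalFunctor.toFunctor F).obj (s M) = M)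
    (hs' : ∀ M, s (enl M) = enl (s M)) : IsEquivalenceOneCell F := by
  have := sectionFunctor_isEquivalence F.toFunctor s hs
  let G : D ⟶ C :=
    { sectionFunctor F.toFunctor s hs with
      -- Strict compatibility with `enl` is the only part of locality that full faithfulness does
      -- not supply. The inclusions are compared after applying `F`, and pullbacks are preserved by
      -- any equivalence.
      map_enl := hs'
      map_η := fun M => F.toFunctor.map_injective (by
        change F.map ((sectionFunctor F.toFunctor s hs).map (η M)) =
          F.map (η (s M) ≫ eqToHom (hs' M).symm)
        rw [map_sectionFunctor_map, F.map_comp, F.map_η, η_congr (hs M), eqToHom_map]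
        simp
        rfl)
      map_isPullback := fun h => h.map (sectionFunctor F.toFunctor s hs) }
  exact ⟨Equivalence.mkOfAdjointifyCounit (f := F) (g := G)
    (LCat.isoOfNatIso (F := 𝟙 C) (G := F ≫ G) (sectionFunctorUnit F.toFunctor s hs))
    (LCat.isoOfNatIso (F := G ≫ F) (G := 𝟙 D)
      (eqToIso (sectionFunctor_comp F.toFunctor s hs))), rfl⟩

/-! ### The comparison with the restriction category of the local category -/

section Unit

variable {X : Type u} [Category.{u} X] [RestrictionStructure X]

/-- The idempotent of `U.dom` is `res U.hom.hom`, by the definition of a morphism of `LocObj X`. So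
the base of the domain and the underlying morphism already determine `U`, and no separate comparison
of domains is needed. -/
lemma toResLoc_map_heq {A B : X} (f : A ⟶ B) {A' B' : ResObj (LocObj X)} (U : PMap A' B')
    (hA : (toResLoc X).obj A = A') (hB : (toResLoc X).obj B = B') (hb : U.dom.base = A)
    (hf : HEq f U.hom.hom) : HEq ((toResLoc X).map f) U.toHom := by
  have hd : (⟨A, res f, res_res f⟩ : LocObj X) = U.dom := by
    obtain ⟨⟨D, d, hd⟩, e, ⟨g, hg, hg'⟩⟩ := U
    subst hA hB
    obtain rfl : D = A := hb
    obtain rfl : f = g := eq_of_heq hf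
    exact LocObj.ext_heq rfl (heq_of_eq hg)
  exact PMap.toHom_heq hA hB hd
    (LocObj.hom_heq hd (congrArg ResObj.obj hB) hf)

lemma toResLoc_map_res {A B : X} (f : A ⟶ B) :
    (toResLoc X).map (res f) = res ((toResLoc X).map f) :=
  eq_of_heq (toResLoc_map_heq (res f) (PMap.restr (A := (toResLoc X).obj A)
    (B := (toResLoc X).obj B) ⟨⟨A, res f, res_res f⟩, rfl, ⟨f, rfl, Category.comp_id f⟩⟩)
    rfl rfl rfl (heq_of_eq (Category.comp_id (res f)).symm))

/-- The relation `res f ≫ g = f` is the restriction order `f ≤ g`. An isomorphism between the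
representatives has underlying morphism `res f`, whence `f ≤ g`; symmetry and antisymmetry of the
order give `f = g`. -/
instance : (toResLoc X).Faithful where
  map_injective {A B f g} h := by
    have key : ∀ {f g : A ⟶ B}, (toResLoc X).map f = (toResLoc X).map g → res f ≫ g = f := by
      intro f g h
      obtain ⟨φ, h₁, h₂⟩ := PMap.toHom_eq_iff.1 h
      have e₁ : φ.hom.hom ≫ res g = res f := by
        have h : φ.hom.hom ≫ res g ≫ 𝟙 A = res f ≫ 𝟙 A := congrArg LocHom.hom h₁
        rwa [Category.comp_id, Category.comp_id] at h
      have e₂ : φ.hom.hom ≫ g = f := congrArg LocHom.hom h₂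
      have e₃ : φ.hom.hom ≫ res g = φ.hom.hom := φ.hom.hom_idem
      rw [← e₁, e₃, e₂]
    have hf := key h
    have hg := key h.symm
    calc f = res f ≫ res g ≫ f := by rw [hg, hf]
      _ = res g ≫ f := by
        rw [← Category.assoc, RestrictionStructure.res_comm, Category.assoc,
          RestrictionStructure.res_comp_self]
      _ = g := hg

instance : (toResLoc X).Full where
  map_surjective {A B} k := by
    obtain ⟨⟨⟨D, d, hd⟩, e, ⟨f, hf, hf'⟩⟩, rfl⟩ := PMap.toHom_surjective k
    -- Enlarging in `LocObj X` keeps the base, so the domain lives on `A` itself and its morphism is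
    -- a preimage.
    obtain rfl : D = A := congrArg LocObj.base e
    exact ⟨f, eq_of_heq (toResLoc_map_heq f _ rfl rfl rfl HEq.rfl)⟩

lemma LocObj.idem_eq_id_of_isTotalObj {A : LocObj X} (h : IsTotalObj A) : A.idem = 𝟙 A.base := by
  obtain ⟨A, a, ha⟩ := A
  obtain ⟨h, -⟩ := h
  have : (⟨A, 𝟙 A, res_id A⟩ : LocObj X) = ⟨A, a, ha⟩ := h
  injection this with _ h'
  exact h'.symm

/-- Taking bases inverts `toResLoc` on objects: totality leaves no idempotent but the identity. -/
lemma toResLoc_obj_base (R : ResObj (LocObj X)) : (toResLoc X).obj R.obj.base = R :=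
  ResObj.ext_obj (LocObj.ext_heq rfl (heq_of_eq (LocObj.idem_eq_id_of_isTotalObj R.total).symm))

end Unit

/-- The 1-cell from a restriction category to the restriction category of its local category. -/
def RCat.unit (X : RCat.{u}) : X ⟶ X.loc.res :=
  RestrictionFunctor.mk (toResLoc X.carrier) toResLoc_map_res

lemma RCat.isIsoOneCell_unit (X : RCat.{u}) : IsIsoOneCell X.unit := by
  have : (RestrictionFunctor.toFunctor X.unit).Full :=
    inferInstanceAs (toResLoc X.carrier).Full
  have : (RestrictionFunctor.toFunctor X.unit).Faithful :=
    inferInstanceAs (toResLoc X.carrier).Faithful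
  exact RCat.isIsoOneCell_of_fullyFaithful X.unit (fun R => R.obj.base) toResLoc_obj_base
    fun _ => rfl

/-- The idempotents are `𝟙` and `F.map (𝟙 A)`, equal by functoriality but not by definition; this is
why naturality is proved with `HEq`. -/
lemma toResLoc_obj_map {X Y : Type u} [Category.{u} X] [Category.{u} Y] [RestrictionStructure X]
    [RestrictionStructure Y] (F : RestrictionFunctor X Y) (A : X) :
    (toResLoc Y).obj (F.obj A) = F.loc.mapResObj ((toResLoc X).obj A) :=
  ResObj.ext_obj (LocObj.ext_heq rfl (heq_of_eq (F.map_id A).symm))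

lemma RCat.unit_naturality {X Y : RCat.{u}} (F : X ⟶ Y) :
    F ≫ Y.unit = X.unit ≫ LCat.resMap (RCat.locMap F) :=
  RestrictionFunctor.ext' (CategoryTheory.Functor.hext (toResLoc_obj_map F) fun A B f =>
    toResLoc_map_heq (F.map f) (F.loc.mapPMap _) (toResLoc_obj_map F A) (toResLoc_obj_map F B)
      rfl HEq.rfl)

/-- The comparison 1-cells into the restriction categories of local categories are 2-natural. -/
def unitTrans :
    TwoNatTrans (StrictPseudofunctor.id RCat.{u}) (locFunctor.comp resFunctor) where
  app X := X.unit
  naturality F := RCat.unit_naturality F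
  naturality₂ {X Y F G} θ := RCat.eq_eqToHom_comp (RCat.unit_naturality F)
    (RCat.unit_naturality G).symm fun A =>
      toResLoc_map_heq (θ.nat.app A) _ (toResLoc_obj_map F A) (toResLoc_obj_map G A) rfl
        (heq_of_eq (by
          -- The induced local 2-cell precomposes with the image of the idempotent, here that of `𝟙
          -- A`.
          change θ.nat.app A = F.map (𝟙 A) ≫ θ.nat.app A
          rw [F.map_id, Category.id_comp]))

/-! ### The comparison with the local category of the restriction category -/

section Counit

variable {C : Type u} [Category.{u} C] [LocalStructure C]

/-- An isomorphism of representatives is an endomorphism of `M` over `η M`, hence the identity as `η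
M` is monic; then `η N` is cancelled. -/
instance : (toLocRes C).Faithful where
  map_injective {M N f g} h := by
    obtain ⟨φ, h₁, h₂⟩ := PMap.toHom_eq_iff.1 (congrArg LocHom.hom h)
    rw [PMap.ofLocal_incl, PMap.ofLocal_incl] at h₁
    have hφ : φ.hom = 𝟙 M := (cancel_mono (η M)).1 (h₁.trans (Category.id_comp _).symm)
    rw [hφ] at h₂
    exact (cancel_mono (η N)).1 ((Category.id_comp _).symm.trans h₂).symm

/-- The restriction condition gives `φ : U ≅ M` over `enl M`. Absorption of `[N, η N]` gives `ψ : U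
≅ W`, where `W` is the pullback of `η N` along `f` with projection `p` to `N`, so that `f = ψ ≫ p ≫
η N`. The preimage is therefore `φ⁻¹ ≫ ψ ≫ p`. -/
instance : (toLocRes C).Full where
  map_surjective {M N} k := by
    obtain ⟨k, hk, hk'⟩ := k
    obtain ⟨⟨U, hU, f⟩, rfl⟩ := PMap.toHom_surjective k
    obtain ⟨φ, h₁, -⟩ := PMap.toHom_eq_iff.1 hk
    obtain ⟨W, hW⟩ := PMap.exists_isComp (⟨U, hU, f⟩ : PMap ⟨enl M, isTotalObj_enl M⟩
      ⟨enl N, isTotalObj_enl N⟩) (PMap.ofLocal N (B := ⟨enl N, isTotalObj_enl N⟩) (η N))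
    obtain ⟨ψ, -, h₂⟩ := PMap.toHom_eq_iff.1 (hk'.symm.trans hW.eq)
    obtain ⟨p, m, hp, hi, hh⟩ := hW
    refine ⟨φ.inv ≫ ψ.hom ≫ p, LocObj.hom_ext (PMap.toHom_eq_iff.2 ⟨φ.symm, ?_, ?_⟩)⟩
    · exact (Iso.inv_comp_eq φ).2 h₁.symm
    · change φ.inv ≫ f = (φ.inv ≫ ψ.hom ≫ p) ≫ η N
      have e₁ : p ≫ η N = W.hom := hh
      have e₂ : ψ.hom ≫ W.hom = f := h₂
      refine ((Category.assoc φ.inv (ψ.hom ≫ p) (η N)).trans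
        (congrArg (fun x => φ.inv ≫ x) ?_)).symm
      exact (Category.assoc _ _ _).trans ((congrArg (fun x => ψ.hom ≫ x) e₁).trans e₂)

lemma ResObj.exists_eq_incl {A : ResObj C} {e : A ⟶ A} (he : res e = e) :
    ∃ U : PMap A A, e = U.toHom ∧ U.hom = U.incl := by
  obtain ⟨U, rfl⟩ := PMap.toHom_surjective e
  exact ⟨U.restr, he.symm, rfl⟩

/-- Recognition of images of objects: `U.incl` is `η M` up to transport, so a representative of the
idempotent given by its own inclusion is `[M, η M]`. -/
lemma toLocRes_obj_eq {M : C} {X : LocObj (ResObj C)} (h : enl M = X.base.obj)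
    {U : PMap X.base X.base} (hU : X.idem = U.toHom) (hd : U.dom = M) (hi : U.hom = U.incl) :
    (toLocRes C).obj M = X := by
  have hb : (⟨enl M, isTotalObj_enl M⟩ : ResObj C) = X.base := ResObj.ext_obj h
  refine LocObj.ext_heq hb ?_
  rw [hU]
  refine PMap.toHom_heq hb hb hd.symm ?_
  rw [hi]
  subst hd
  exact (comp_eqToHom_heq _ _).symm

/-- The domain of a representative of the idempotent is a preimage. It need not be unique: any
domain isomorphic to it over the same enlargement serves as well. -/
lemma exists_toLocRes_obj_eq (X : LocObj (ResObj C)) : ∃ M : C, (toLocRes C).obj M = X := by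
  obtain ⟨U, hU, hi⟩ := ResObj.exists_eq_incl X.res_idem
  exact ⟨U.dom, toLocRes_obj_eq U.enl_dom hU rfl hi⟩

lemma toLocRes_obj_of_isTotalObj {M : C} (hM : IsTotalObj M) :
    (toLocRes C).obj M = ⟨⟨M, hM⟩, 𝟙 _, res_id _⟩ :=
  toLocRes_obj_eq hM.1 (U := PMap.ofHom (A := ⟨M, hM⟩) (B := ⟨M, hM⟩) (𝟙 M)) rfl rfl
    (PMap.ofHom_incl (A := ⟨M, hM⟩) (B := ⟨M, hM⟩) (𝟙 M)).symm

open Classical in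
/-- A section on objects of `toLocRes C`, which sends total objects to total objects. -/
noncomputable def toLocResSection (X : LocObj (ResObj C)) : C :=
  -- A preimage of `X` has enlargement `X.base.obj`, so compatibility with `enl` forces this value
  -- at identity idempotents. Elsewhere any choice works.
  if X.idem = 𝟙 _ then X.base.obj else (exists_toLocRes_obj_eq X).choose

lemma toLocRes_obj_section (X : LocObj (ResObj C)) :
    (toLocRes C).obj (toLocResSection X) = X := by
  unfold toLocResSection
  split_ifs with h
  · rw [toLocRes_obj_of_isTotalObj X.base.total]
    exact LocObj.ext_heq rfl (heq_of_eq h.symm)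
  · exact (exists_toLocRes_obj_eq X).choose_spec

lemma toLocResSection_enl (X : LocObj (ResObj C)) :
    toLocResSection (enl X) = enl (toLocResSection X) := by
  have h₁ : toLocResSection (enl X) = X.base.obj := if_pos rfl
  have h₂ : enl (toLocResSection X) = X.base.obj :=
    congrArg (fun Y : LocObj (ResObj C) => Y.base.obj) (toLocRes_obj_section X)
  exact h₁.trans h₂.symm

lemma toLocRes_obj_enl (M : C) : (toLocRes C).obj (enl M) = enl ((toLocRes C).obj M) :=
  toLocRes_obj_of_isTotalObj (isTotalObj_enl M)

/-- The counterpart of `toResLoc_map_heq` for `E`. The domain must now be matched explicitly. -/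
lemma toLocRes_map_heq {M N : C} (f : M ⟶ N) {X Y : LocObj (ResObj C)}
    (hX : (toLocRes C).obj M = X) (hY : (toLocRes C).obj N = Y) {g : X ⟶ Y}
    {U : PMap X.base Y.base} (hg : g.hom = U.toHom) (hd : M = U.dom)
    (hf : HEq (f ≫ η N) U.hom) : HEq ((toLocRes C).map f) g :=
  LocObj.hom_heq hX hY (by
    rw [hg]
    exact PMap.toHom_heq (congrArg LocObj.base hX) (congrArg LocObj.base hY) hd hf)

lemma toLocRes_map_η (M : C) : HEq ((toLocRes C).map (η M)) (η ((toLocRes C).obj M)) :=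
  toLocRes_map_heq (η M) rfl (toLocRes_obj_enl M) (U := PMap.ofLocal M (η M)) rfl rfl (by
    rw [LocalStructure.η_enl]
    exact comp_eqToHom_heq _ _)

end Counit

/-- The 1-cell from a local category to the local category of its restriction category. -/
noncomputable def LCat.counit (C : LCat.{u}) : C ⟶ C.res.loc :=
  LocalFunctor.mk (toLocRes C.carrier) toLocRes_obj_enl
    (fun M => eq_of_heq ((toLocRes_map_η M).trans (comp_eqToHom_heq _ _).symm))
    (fun h => by
      -- As an equivalence of categories, the functor preserves all pullbacks, in particular those
      -- of maximal inclusions.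
      have := isEquivalence_of_section (toLocRes C.carrier) toLocResSection toLocRes_obj_section
      exact h.map (toLocRes C.carrier))

lemma LCat.isEquivalenceOneCell_counit (C : LCat.{u}) : IsEquivalenceOneCell C.counit := by
  have : (LocalFunctor.toFunctor C.counit).Full :=
    inferInstanceAs (toLocRes C.carrier).Full
  have : (LocalFunctor.toFunctor C.counit).Faithful :=
    inferInstanceAs (toLocRes C.carrier).Faithful
  exact LCat.isEquivalenceOneCell_of_fullyFaithful C.counit toLocResSection toLocRes_obj_section
    toLocResSection_enl

lemma toLocRes_obj_map {C D : Type u} [Category.{u} C] [Category.{u} D] [LocalStructure C]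
    [LocalStructure D] (F : LocalFunctor C D) (M : C) :
    (toLocRes D).obj (F.obj M) = F.resF.loc.obj ((toLocRes C).obj M) :=
  toLocRes_obj_eq (X := F.resF.loc.obj ((toLocRes C).obj M)) (F.map_enl M).symm
    (U := F.mapPMap (PMap.ofLocal M (B := ⟨enl M, isTotalObj_enl M⟩) (η M))) rfl rfl
    ((F.mapPMap_incl (PMap.ofLocal M (B := ⟨enl M, isTotalObj_enl M⟩) (η M))).trans
      (congrArg F.map (PMap.ofLocal_incl M (B := ⟨enl M, isTotalObj_enl M⟩) (η M)))).symm

lemma LCat.counit_naturality {C D : LCat.{u}} (F : C ⟶ D) :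
    F ≫ D.counit = C.counit ≫ RCat.locMap (LCat.resMap F) :=
  LocalFunctor.ext' (CategoryTheory.Functor.hext (toLocRes_obj_map F) fun M N f =>
    toLocRes_map_heq (F.map f) (toLocRes_obj_map F M) (toLocRes_obj_map F N)
      (U := F.mapPMap (PMap.ofLocal M (B := ⟨enl N, isTotalObj_enl N⟩) (f ≫ η N))) rfl rfl (by
        change HEq (F.map f ≫ η (F.obj N)) (F.map (f ≫ η N))
        rw [F.map_comp, F.map_η, ← Category.assoc]
        exact (comp_eqToHom_heq _ _).symm))

/-- The comparison 1-cells into the local categories of restriction categories are 2-natural. -/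
noncomputable def counitTrans :
    TwoNatTrans (StrictPseudofunctor.id LCat.{u}) (resFunctor.comp locFunctor) where
  app C := C.counit
  naturality F := LCat.counit_naturality F
  naturality₂ {C D F G} θ := LCat.eq_eqToHom_comp (LCat.counit_naturality F)
    (LCat.counit_naturality G).symm fun M =>
      toLocRes_map_heq (θ.nat.app M) (toLocRes_obj_map F M) (toLocRes_obj_map G M)
        -- This represents the composite of the idempotent `[F M, F (η M)]` with the everywhere
        -- defined component at `enl M`. Naturality of `θ` at `η M` turns it into `θ_M` followed by
        -- `η (G M)`, up to transport.
        (U := ⟨F.obj M, (F.map_enl M).symm, F.map (η M) ≫ θ.nat.app (enl M)⟩)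
        (PMap.isComp_ofHom (A := F.mapResObj ⟨enl M, isTotalObj_enl M⟩)
          (B := F.mapResObj ⟨enl M, isTotalObj_enl M⟩)
          (D := G.mapResObj ⟨enl M, isTotalObj_enl M⟩)
          (F.mapPMap (PMap.ofLocal M (B := ⟨enl M, isTotalObj_enl M⟩) (η M)))
          (θ.nat.app (enl M))).eq rfl (by
            change HEq (θ.nat.app M ≫ η (G.obj M)) (F.map (η M) ≫ θ.nat.app (enl M))
            rw [θ.nat.naturality, G.map_η, ← Category.assoc]
            exact (comp_eqToHom_heq _ _).symm)

/-! ### The triangle identities -/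

lemma RCat.loc_unit_obj (X : RCat.{u}) (A : X.loc.carrier) :
    (LocalFunctor.toFunctor (RCat.locMap X.unit)).obj A = (toLocRes X.loc.carrier).obj A :=
  LocObj.ext_heq rfl (toResLoc_map_heq A.idem (PMap.ofLocal A
    (B := ⟨enl A, isTotalObj_enl A⟩) (η A)) rfl rfl rfl HEq.rfl)

/-- On a morphism `f` into `(B, b)`, one side has representative `f` and the other `f ≫ b`; these
agree because morphisms of `LocObj` absorb the idempotent of their codomain. -/
lemma RCat.locMap_unit (X : RCat.{u}) : RCat.locMap X.unit = X.loc.counit :=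
  LocalFunctor.ext' (CategoryTheory.Functor.hext X.loc_unit_obj fun A B f =>
    LocObj.hom_heq (X.loc_unit_obj A) (X.loc_unit_obj B)
      (toResLoc_map_heq f.hom (PMap.ofLocal A (B := ⟨enl B, isTotalObj_enl B⟩) (f ≫ η B)) rfl rfl
        rfl (heq_of_eq f.hom_idem.symm)))

lemma LCat.res_counit_obj (C : LCat.{u}) (M : C.res.carrier) :
    (RestrictionFunctor.toFunctor (LCat.resMap C.counit)).obj M =
      (toResLoc C.res.carrier).obj M :=
  ResObj.ext_obj (toLocRes_obj_of_isTotalObj M.total)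

/-- For a class `[U, f]`, the image of `U` under `E` is `M` with the idempotent `[U, η U]`, the
restriction of `[U, f]`, so the domains agree. The morphisms agree because `N` is total: `f ≫ η N`
is `f` up to transport. -/
lemma LCat.resMap_counit (C : LCat.{u}) : LCat.resMap C.counit = C.res.unit :=
  RestrictionFunctor.ext' (CategoryTheory.Functor.hext C.res_counit_obj fun M N f => by
    obtain ⟨U, rfl⟩ := PMap.toHom_surjective f
    have hd : (toLocRes C.carrier).obj U.dom =
        (⟨M, RestrictionStructure.res U.toHom, res_res U.toHom⟩ : LocObj (ResObj C.carrier)) :=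
      toLocRes_obj_eq U.enl_dom (U := U.restr) rfl rfl rfl
    refine PMap.toHom_heq (C.res_counit_obj M) (C.res_counit_obj N)
      (U := LocalFunctor.mapPMap C.counit U) hd ?_
    refine toLocRes_map_heq U.hom hd (congrArg ResObj.obj (C.res_counit_obj N)) (U := U) rfl rfl ?_
    rw [N.total.2]
    exact comp_eqToHom_heq _ _)

/-! ### Split restriction categories and split local categories -/

/-- A section `s` is total, and then `res r = res (r ≫ s) = a`. So `r` and `s` are morphisms between
`(A, a)` and `(E, 𝟙 E)`; they are mutually inverse because the identity of `(A, a)` is `a`. -/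
lemma RCat.IsSplit.loc {X : RCat.{u}} (hX : X.IsSplit) : X.loc.IsSplit := by
  rintro ⟨A, a, ha⟩
  obtain ⟨E, s, r, hsr, hrs⟩ := hX A a ha
  have hs : res s = 𝟙 E := by
    have h := RestrictionStructure.res_comp_res (s ≫ r) s
    rw [← Category.assoc, RestrictionStructure.res_comp_self, hsr, res_id, Category.comp_id] at h
    exact h
  have hr : res r = a := by
    rw [← ha, ← hrs, res_comp_eq, hs, Category.comp_id]
  have hsa : s ≫ a = s := by rw [← hrs, ← Category.assoc, hsr, Category.id_comp]
  exact ⟨⟨E, 𝟙 E, res_id E⟩, ⟨rfl, rfl⟩, ⟨⟨⟨r, hr, Category.comp_id r⟩, ⟨s, hs, hsa⟩,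
    LocObj.hom_ext hrs, LocObj.hom_ext hsr⟩⟩⟩

/-- An isomorphism `i` from the domain to a total object `E` yields the splitting: `s` is the
everywhere defined `i⁻¹ ≫ U.incl`, and `r` is the partial map `i` on `U.dom`. -/
lemma PMap.exists_splitting_restr {C : Type u} [Category.{u} C] [LocalStructure C]
    {A B : ResObj C} (U : PMap A B) (hU : ObjSplits U.dom) :
    ∃ (E : ResObj C) (s : E ⟶ A) (r : A ⟶ E), s ≫ r = 𝟙 E ∧ r ≫ s = U.restr.toHom := by
  obtain ⟨E, hE, ⟨i⟩⟩ := hU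
  let E' : ResObj C := ⟨E, hE⟩
  let s : PMap E' A := PMap.ofHom (i.inv ≫ U.incl)
  let r : PMap A E' := ⟨U.dom, U.enl_dom, i.hom⟩
  have hs : s.incl = 𝟙 E := PMap.ofHom_incl (A := E') (B := A) _
  refine ⟨E', s.toHom, r.toHom, PMap.IsComp.eq (U := s) (V := r)
    (W := PMap.ofHom (A := E') (B := E') (𝟙 E))
    ⟨i.inv, 𝟙 E, ?_, ?_, i.inv_hom_id⟩, (PMap.isComp_ofHom r (i.inv ≫ U.incl)).eq.trans ?_⟩
  · change IsPullback i.inv (𝟙 E) U.incl (i.inv ≫ U.incl)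
    -- Since `U.incl` is monic, pulling it back along `i⁻¹ ≫ U.incl` gives all of `E`.
    simpa using (IsPullback.of_id_snd (f := i.inv)).paste_horiz (IsKernelPair.id_of_mono U.incl)
  · rw [hs, PMap.ofHom_incl (A := E') (B := E')]
    exact Category.comp_id _
  · exact congrArg (fun f => (PMap.mk U.dom U.enl_dom f : PMap A A).toHom)
      (i.hom_inv_id_assoc U.incl)

lemma LCat.IsSplit.res {C : LCat.{u}} (hC : C.IsSplit) : C.res.IsSplit := by
  intro A e he
  obtain ⟨U, rfl⟩ := PMap.toHom_surjective e
  obtain ⟨E, s, r, h₁, h₂⟩ := U.exists_splitting_restr (hC U.dom)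
  exact ⟨E, s, r, h₁, h₂.trans he⟩

/-! ### Assembly of the 2-equivalences -/

lemma isTwoEquivalence_locFunctor_resFunctor :
    IsTwoEquivalence locFunctor.{u} resFunctor.{u} unitTrans counitTrans where
  unit_equivalence X := X.isIsoOneCell_unit.isEquivalenceOneCell
  counit_equivalence C := C.isEquivalenceOneCell_counit
  triangle_left X := X.locMap_unit
  triangle_right C := C.resMap_counit

end Partiality

theorem mainTheorem7 :
    ∃ (N : TwoNatTrans (StrictPseudofunctor.id RCat.{u}) (locFunctor.comp resFunctor))
      (E : TwoNatTrans (StrictPseudofunctor.id LCat.{u}) (resFunctor.comp locFunctor))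
      (hL : ∀ X : RCat.{u}, X.IsSplit → (locFunctor.obj X).IsSplit)
      (hR : ∀ C : LCat.{u}, C.IsSplit → (resFunctor.obj C).IsSplit),
      (∀ X : RCat.{u}, RestrictionFunctor.toFunctor (N.app X) = toResLoc X.carrier) ∧
      (∀ C : LCat.{u}, LocalFunctor.toFunctor (E.app C) = toLocRes C.carrier) ∧
      IsTwoEquivalence locFunctor resFunctor N E ∧
      (∀ X : RCat.{u}, IsIsoOneCell (N.app X)) ∧
      IsTwoEquivalence (B := SRCat.{u}) (C := SLCat.{u})
        (restrictFunctor locFunctor hL) (restrictFunctor resFunctor hR)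
        (restrictTrans locFunctor resFunctor hL hR N)
        (restrictTrans resFunctor locFunctor hR hL E) ∧
      (∀ X : SRCat.{u}, IsIsoOneCell ((restrictTrans locFunctor resFunctor hL hR N).app X)) :=
  ⟨unitTrans, counitTrans, fun _ h => h.loc, fun _ h => h.res, fun _ => rfl, fun _ => rfl,
    isTwoEquivalence_locFunctor_resFunctor, fun X => X.isIsoOneCell_unit,
    isTwoEquivalence_locFunctor_resFunctor.restrict _ _,
    fun X => FullSub.isIsoOneCell X.1.isIsoOneCell_unit⟩
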